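/- A machine is a partial computable function $U$ that maps a pair of binary strings (a program $p$ and a condition $y$) to a binary string. For a machine $U$ and binary strings $x,y$, let $C_U(x\mid y)=\min\{|p| : U(p,y)=x\}$ (with $\min\emptyset=\infty$). The machine is prefix-free if, whenever $U(p,y)$ halts, $U(q,y)$ halts for no proper prefix $q$ of $p$. A machine $U$ is optimal if for every machine $W$ there is a constant $c_W$ with $C_U(x\mid y)\le C_W(x\mid y)+c_W$ for all $x,y$; an optimal prefix-free machine is a prefix-free machine $V$ with this property relative to all prefix-free machines $W$. Fix an optimal machine $U$ and an optimal prefix-free machine $V$. Write $C(x\mid y)=C_U(x\mid y)$ (plain complexity), $K(x\mid y)=C_V(x\mid y)$ (prefix-free complexity), and $K(x)=K(x\mid\text{empty string})$; $K$ and $C$ take only finite values. Natural numbers are identified with their binary expansions when they are described by programs, and $\log$ is the logarithm to base $2$. **Theorem.** There is a constant $c$ such that for every $n$ there is a binary string $x$ of length $n$ with $$C(K(x)\mid x)\ \ge\ \log n-c\qquad\text{and}\qquad K(x)\ \ge\ n/2,$$ and such that, consequently, also $K(K(x)\mid x)\ge \log n-c$. (For $n=0$ the two inequalities that contain $\log n$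 impose no condition.) -/

import Mathlib

namespace Kolmogorov

/-- A machine maps a program `p` and a condition `y` to an output, if it halts on `(p, y)`.
It is a machine proper only if it is computable (see `IsOptimal` and `IsPrefixOptimal`). -/
abbrev Machine : Type := List Bool → List Bool →. List Bool

/-- For every condition `y`, no program on which `U` halts is a proper prefix of another one. -/
def PrefixFree (U : Machine) : Prop :=
  ∀ y p q : List Bool, (U p y).Dom → (U q y).Dom → q <+: p → q = p

/-- `complexity U x y` is the least length of a program `p` with `U(p, y) = x`
(it is `⊤` if there is no such program). -/
noncomputable def complexity (U : Machine) (x y : List Bool) : ℕ∞ :=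
  ⨅ (p : List Bool) (_ : x ∈ U p y), (p.length : ℕ∞)

/-- A computable machine whose complexity is minimal, up to an additive constant, among all
computable machines. -/
def IsOptimal (U : Machine) : Prop :=
  Partrec₂ U ∧ ∀ W : Machine, Partrec₂ W →
    ∃ c : ℕ, ∀ x y : List Bool, complexity U x y ≤ complexity W x y + c

/-- A computable prefix-free machine whose complexity is minimal, up to an additive constant,
among all computable prefix-free machines. -/
def IsPrefixOptimal (V : Machine) : Prop :=
  Partrec₂ V ∧ PrefixFree V ∧ ∀ W : Machine, Partrec₂ W → PrefixFree W →
    ∃ c : ℕ, ∀ x y : List Bool, complexity V x y ≤ complexity W x y + c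

end Kolmogorov

/-! The proof is a game on the strings of length `n`, played by issuing requests for short
prefix-free programs. By the Kraft–Chaitin theorem (`IsPrefixOptimal.exists_complexity_le`), a
computable sequence of requests of bounded total weight is served by `V` up to a constant `c`. The
game needs `c`, while `c` depends on the requests. So the games for all values of `c` are played at
once, and the weight of the games for `c` is scaled by `2 ^ (-c)`.

A game has `2 ^ logStages` stages, where `logStages` is about `log n - (2 * c + 5)`. To stage `i`
belong a range of complexities, of length `gap` and starting at `lower i`, and a set of `2 ^ logSize
i` strings. The ranges of different stages are disjoint, and each set contains the next. On entering
the stage, programs are requested for its strings that force `K x` below the top of the range. The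
stage ends once every string is seen either to have `K x < lower i` ("low") or to have a value in
the range guessed from `x` by a program for `U` shorter than `logStages - 1` ("hit"). If the theorem
failed, one of the two would happen to each string, because `lower i ≥ n / 2`; so all stages would
end (`exists_settled`).

The next set consists of hit strings if there are enough of them. Otherwise at least half of the
strings are low, and the stage is cheap. Cheap stages use up weight `∑ 2 ^ (-K x)` over the strings
of length `n`, so at most half of all stages are cheap (`card_cheap_le`). A string that survives to
the end is hit in all other stages, by different programs since the ranges are disjoint, and there
are too few short programs for that (`card_guessed_lt`).

The parameter `s` calibrates the weights: up to a constant factor, `2 ^ (-s)` has to be the total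
weight of the programs for strings of length `n`. This weight is only approximable from below, so a
game for each `s` is launched once weight `2 ^ (-s)` has been seen. The requests of the launched
games form a geometric series bounded by the weight itself, and Kraft's inequality bounds the sum
over all `n` (`tsum_requests_le`). The decisive game is that with the least launched `s`
(`exists_launched`). -/

open scoped ENNReal

namespace Kolmogorov

/-! ### Binary strings -/

/-- All binary strings of length `n`. -/
def strings : ℕ → List (List Bool)
  | 0 => [[]]
  | n + 1 => (strings n).map (List.cons false) ++ (strings n).map (List.cons true)

theorem mem_strings {n : ℕ} {p : List Bool} : p ∈ strings n ↔ p.length = n := by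
  induction n generalizing p with
  | zero => simp [strings]
  | succ n ih =>
    rcases p with _ | ⟨b, p⟩
    · simp [strings]
    · cases b <;> simp [strings, ih]

theorem nodup_strings (n : ℕ) : (strings n).Nodup := by
  induction n with
  | zero => simp [strings]
  | succ n ih =>
    refine List.Nodup.append (ih.map (List.cons_injective)) (ih.map (List.cons_injective)) ?_
    intro p hp hp'
    simp only [List.mem_map] at hp hp'
    obtain ⟨_, _, rfl⟩ := hp
    obtain ⟨_, _, h⟩ := hp'
    simp at h

theorem length_strings (n : ℕ) : (strings n).length = 2 ^ n := by
  induction n with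
  | zero => simp [strings]
  | succ n ih => simp [strings, ih, pow_succ]; ring

/-- All binary strings of length less than `b`. -/
def shortStrings (b : ℕ) : List (List Bool) := (List.range b).flatMap strings

theorem mem_shortStrings {b : ℕ} {p : List Bool} : p ∈ shortStrings b ↔ p.length < b := by
  simp [shortStrings, mem_strings]

theorem length_shortStrings (b : ℕ) : (shortStrings b).length + 1 = 2 ^ b := by
  induction b with
  | zero => simp [shortStrings]
  | succ b ih =>
    have : shortStrings (b + 1) = shortStrings b ++ strings b := by
      simp [shortStrings, List.range_succ]
    rw [this, List.length_append, length_strings, pow_succ]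
    omega

theorem card_le_of_length_lt {b : ℕ} {F : Finset (List Bool)} (h : ∀ p ∈ F, p.length < b) :
    F.card + 1 ≤ 2 ^ b := by
  rw [← length_shortStrings b]
  have : F ⊆ (shortStrings b).toFinset := fun p hp => by
    simpa [mem_shortStrings] using h p hp
  have := (Finset.card_le_card this).trans (List.toFinset_card_le _)
  omega

/-- The number with binary expansion `p`, least significant bit first. -/
def lsbVal (p : List Bool) : ℕ := p.foldr (fun b a => b.toNat + 2 * a) 0

theorem lsbVal_bits (k : ℕ) : lsbVal k.bits = k := by
  induction k using Nat.binaryRec' with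
  | zero => simp [lsbVal]
  | bit b n h ih =>
    rw [Nat.bits_append_bit n b h]
    have : lsbVal (b :: n.bits) = b.toNat + 2 * lsbVal n.bits := rfl
    rw [this, ih, Nat.bit_val]; ring

/-- The number with binary expansion `p`, most significant bit first. -/
def msbVal (p : List Bool) : ℕ := p.foldl (fun a b => 2 * a + b.toNat) 0

theorem msbVal_concat (p : List Bool) (b : Bool) : msbVal (p ++ [b]) = 2 * msbVal p + b.toNat := by
  simp [msbVal]

/-- In terms of dyadic intervals: the interval of an extension of `p` lies inside the interval of
`p`. This turns prefix-freeness into disjointness of intervals. -/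
theorem msbVal_append (p r : List Bool) :
    msbVal p * 2 ^ r.length ≤ msbVal (p ++ r) ∧
      msbVal (p ++ r) + 1 ≤ (msbVal p + 1) * 2 ^ r.length := by
  induction r using List.reverseRecOn with
  | nil => simp
  | append_singleton r b ih =>
    rw [← List.append_assoc, msbVal_concat, List.length_append, List.length_singleton, pow_succ]
    have := Bool.toNat_le b
    constructor <;> nlinarith [ih.1, ih.2]

theorem exists_msbVal {l q : ℕ} (h : q < 2 ^ l) : ∃ p : List Bool, p.length = l ∧ msbVal p = q := by
  induction l generalizing q with
  | zero => exact ⟨[], rfl, by simp at h; simp [msbVal, h]⟩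
  | succ l ih =>
    obtain ⟨p, hp, hq⟩ := ih (q := q / 2) (by rw [pow_succ] at h; omega)
    refine ⟨p ++ [decide (q % 2 = 1)], by simp [hp], ?_⟩
    rw [msbVal_concat, hq]
    by_cases h2 : q % 2 = 1 <;> simp [h2] <;> omega

/-! ### Primitive recursive tools -/

theorem primrec_nat_pow : Primrec₂ ((· ^ ·) : ℕ → ℕ → ℕ) := Primrec₂.unpaired'.1 Nat.Primrec.pow

theorem primrec_toNat : Primrec Bool.toNat := Primrec.dom_bool _

theorem primrec_strings : Primrec strings := by
  have hc (b : Bool) : Primrec₂ fun (_ : ℕ × List (List Bool)) (l : List Bool) => b :: l :=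
    Primrec.list_cons.comp (Primrec.const b) Primrec.snd
  have h : Primrec₂ fun (_ : ℕ) (l : List (List Bool)) =>
      l.map (List.cons false) ++ l.map (List.cons true) :=
    Primrec.list_append.comp (Primrec.list_map Primrec.snd (hc false))
      (Primrec.list_map Primrec.snd (hc true))
  refine (Primrec.nat_rec₁ [[]] h).of_eq fun n => ?_
  induction n with
  | zero => rfl
  | succ n ih => simp only [strings, ← ih]

theorem primrec_shortStrings : Primrec shortStrings :=
  Primrec.list_flatMap Primrec.list_range (primrec_strings.comp Primrec.snd)

theorem primrec_lsbVal : Primrec lsbVal := by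
  have h : Primrec₂ fun (_ : List Bool) (q : Bool × ℕ) => q.1.toNat + 2 * q.2 :=
    Primrec.nat_add.comp (primrec_toNat.comp (Primrec.fst.comp Primrec.snd))
    (Primrec.nat_mul.comp (Primrec.const 2) (Primrec.snd.comp Primrec.snd))
  exact Primrec.list_foldr Primrec.id (Primrec.const 0) h

theorem primrec_msbVal : Primrec msbVal := by
  have h : Primrec₂ fun (_ : List Bool) (q : ℕ × Bool) => 2 * q.1 + q.2.toNat :=
    Primrec.nat_add.comp
    (Primrec.nat_mul.comp (Primrec.const 2) (Primrec.fst.comp Primrec.snd))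
    (primrec_toNat.comp (Primrec.snd.comp Primrec.snd))
  exact Primrec.list_foldl Primrec.id (Primrec.const 0) h

theorem primrec_sum : Primrec (List.sum : List ℕ → ℕ) := by
  have h : Primrec₂ fun (_ : List ℕ) (p : ℕ × ℕ) => p.1 + p.2 :=
    Primrec.nat_add.comp (Primrec.fst.comp Primrec.snd) (Primrec.snd.comp Primrec.snd)
  exact (Primrec.list_foldr Primrec.id (Primrec.const 0) h).of_eq fun l => List.sum_eq_foldr.symm

theorem _root_.PrimrecPred.exists_mem_of {α β : Type*} [Primcodable α] [Primcodable β]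
    {f : α → List β} {R : α → β → Prop} (hf : Primrec f) (hR : PrimrecRel R) :
    PrimrecPred fun a => ∃ b ∈ f a, R a b :=
  hR.swap.exists_mem_list.comp hf Primrec.id

theorem _root_.PrimrecPred.forall_mem_of {α β : Type*} [Primcodable α] [Primcodable β]
    {f : α → List β} {R : α → β → Prop} (hf : Primrec f) (hR : PrimrecRel R) :
    PrimrecPred fun a => ∀ b ∈ f a, R a b :=
  hR.swap.forall_mem_list.comp hf Primrec.id

theorem _root_.Primrec.filter_of {α β : Type*} [Primcodable α] [Primcodable β]
    {f : α → List β} {R : α → β → Prop} [∀ a, DecidablePred (R a)] (hf : Primrec f)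
    (hR : PrimrecRel R) : Primrec fun a => (f a).filter fun b => R a b := by
  have hs : DecidableRel (Function.swap R) := fun b a => inferInstanceAs (Decidable (R a b))
  exact (hR.swap.listFilter.comp hf Primrec.id).of_eq fun a => by
    exact List.filter_congr fun b _ => decide_eq_decide.2 Iff.rfl

/-! ### Approximating a machine in stages -/

/-- `A t p y` is the result of running `U` on `(p, y)` for `t` steps. -/
structure IsStage (U : Machine) (A : ℕ → List Bool → List Bool → Option (List Bool)) : Prop where
  primrec : Primrec fun q : ℕ × List Bool × List Bool => A q.1 q.2.1 q.2.2
  mono : ∀ {s t p y x}, s ≤ t → A s p y = some x → A t p y = some x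
  mem_iff : ∀ {p y x}, x ∈ U p y ↔ ∃ t, A t p y = some x

/-- The step-bounded evaluation `evaln` of a code for `U` is primitive recursive and monotone in the
bound. The game can therefore be primitive recursive itself. -/
theorem exists_isStage {U : Machine} (hU : Partrec₂ U) : ∃ A, IsStage U A := by
  obtain ⟨c, hc⟩ := Nat.Partrec.Code.exists_code.1 hU
  refine ⟨fun t p y => (c.evaln t (Encodable.encode (p, y))).bind Encodable.decode, ?_, ?_, ?_⟩
  · refine Primrec.option_bind ?_ (Primrec.decode.comp Primrec.snd)
    exact Nat.Partrec.Code.primrec_evaln.comp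
      (Primrec.pair (Primrec.pair Primrec.fst (Primrec.const c)) (Primrec.encode.comp Primrec.snd))
  · intro s t p y x hst h
    obtain ⟨k, hk, hx⟩ := Option.bind_eq_some_iff.1 h
    exact Option.bind_eq_some_iff.2 ⟨k, Nat.Partrec.Code.evaln_mono hst hk, hx⟩
  · intro p y x
    have key : ∀ k, k ∈ c.eval (Encodable.encode (p, y)) ↔ ∃ z ∈ U p y, Encodable.encode z = k := by
      intro k
      rw [hc]
      simp
    constructor
    · intro hx
      obtain ⟨t, ht⟩ := Nat.Partrec.Code.evaln_complete.1 ((key _).2 ⟨x, hx, rfl⟩)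
      exact ⟨t, Option.bind_eq_some_iff.2 ⟨_, ht, Encodable.encodek x⟩⟩
    · rintro ⟨t, ht⟩
      obtain ⟨k, hk, hx⟩ := Option.bind_eq_some_iff.1 ht
      obtain ⟨z, hz, rfl⟩ := (key k).1 (Nat.Partrec.Code.evaln_sound hk)
      rw [Encodable.encodek, Option.some_inj] at hx
      exact hx ▸ hz

/-! ### Complexity and programs -/

theorem complexity_le_of_mem {U : Machine} {x y p : List Bool} (h : x ∈ U p y) :
    complexity U x y ≤ p.length := iInf₂_le p h

theorem exists_program {U : Machine} {x y : List Bool} {k : ℕ} (h : complexity U x y ≤ k) :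
    ∃ p, x ∈ U p y ∧ complexity U x y = p.length ∧ p.length ≤ k := by
  have hlt : complexity U x y < ((k + 1 : ℕ) : ℕ∞) :=
    h.trans_lt (by exact_mod_cast Nat.lt_succ_self k)
  have hne : ∃ j : ℕ, ∃ p, x ∈ U p y ∧ p.length = j := by
    obtain ⟨p, hp⟩ := iInf_lt_iff.1 hlt
    obtain ⟨hx, _⟩ := iInf_lt_iff.1 hp
    exact ⟨_, p, hx, rfl⟩
  classical
  obtain ⟨p, hx, hp⟩ := Nat.find_spec hne
  have heq : complexity U x y = p.length := by
    refine le_antisymm (complexity_le_of_mem hx) (le_iInf₂ fun q hq => ?_)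
    rw [hp]
    exact_mod_cast Nat.find_min' hne ⟨q, hq, rfl⟩
  exact ⟨p, hx, heq, by rw [heq] at h; exact_mod_cast h⟩

/-- A fixed string is described by the empty program, so optimal machines give it a finite
complexity. -/
theorem IsPrefixOptimal.exists_eq {V : Machine} (hV : IsPrefixOptimal V) (x y : List Bool) :
    ∃ k : ℕ, complexity V x y = k := by
  obtain ⟨c, hc⟩ := hV.2.2
    (fun p _ => ((if p = [] then some x else none : Option (List Bool)) : Part (List Bool)))
    (by
      refine Computable.ofOption (Primrec.to_comp ?_)
      exact Primrec.ite (Primrec.eq.comp Primrec.fst (Primrec.const [])) (Primrec.const _)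
        (Primrec.const _))
    (by
      intro y p q hp hq _
      by_cases h1 : p = [] <;> by_cases h2 : q = [] <;> simp_all)
  have h := (hc x y).trans (add_le_add_left (complexity_le_of_mem (p := []) (by simp)) _)
  obtain ⟨p, _, h, _⟩ := exists_program (k := c) (by simpa using h)
  exact ⟨_, h⟩

/-! ### Requests for short prefix-free programs -/

/-- The weight `2 ^ (-l)` of a request for a program of length `l`. -/
noncomputable def requestWeight : Option (List Bool × ℕ) → ℝ≥0∞
  | none => 0
  | some (_, l) => 2⁻¹ ^ l

/-- The left end `A / 2 ^ m` of the free part of the unit interval after the first `e` requests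
have been served, as a pair `(m, A)`. A request for length `l` uses up an interval of
length `2 * 2 ^ (-(l + b + 1))`. -/
def allocated (req : ℕ → Option (List Bool × ℕ)) (b : ℕ) : ℕ → ℕ × ℕ
  | 0 => (0, 0)
  | e + 1 =>
    match req e with
    | none => allocated req b e
    | some (_, l) => ((allocated req b e).1 + (l + b + 1),
        (allocated req b e).2 * 2 ^ (l + b + 1) + 2 * 2 ^ (allocated req b e).1)

/-- The number whose expansion of length `l + b + 1` serves request `e` for length `l`. -/
def codeword (req : ℕ → Option (List Bool × ℕ)) (b e l : ℕ) : ℕ :=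
  (allocated req b e).2 * 2 ^ (l + b + 1) / 2 ^ (allocated req b e).1 + 1

/-- The output of program `q.1` if it has the length that serves request `r` and the value `q.2`. -/
def serveWith (b : ℕ) (q : List Bool × ℕ) (r : List Bool × ℕ) : Option (List Bool) :=
  if q.1.length = r.2 + b + 1 ∧ msbVal q.1 = q.2 then some r.1 else none

/-- The output of program `p` if it serves request `e`. -/
def serve (req : ℕ → Option (List Bool × ℕ)) (b : ℕ) (p : List Bool) (e : ℕ) :
    Option (List Bool) :=
  (req e).bind fun r => serveWith b (p, codeword req b e r.2) r

/-- The machine that serves all requests. -/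
def requestMachine (req : ℕ → Option (List Bool × ℕ)) (b : ℕ) : Machine :=
  fun p _ => Nat.rfindOpt (serve req b p)

theorem serve_eq_some {req : ℕ → Option (List Bool × ℕ)} {b : ℕ} {p : List Bool} {e : ℕ}
    {x : List Bool} : serve req b p e = some x ↔ ∃ l, req e = some (x, l) ∧
      p.length = l + b + 1 ∧ msbVal p = codeword req b e l := by
  unfold serve serveWith
  rw [Option.bind_eq_some_iff]
  constructor
  · rintro ⟨⟨z, l⟩, hr, h⟩
    split_ifs at h with hc
    obtain rfl : z = x := by simpa using h
    exact ⟨l, hr, hc⟩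
  · rintro ⟨l, hr, hc⟩
    exact ⟨_, hr, if_pos hc⟩

theorem computable_allocated {req : ℕ → Option (List Bool × ℕ)} (hreq : Computable req) (b : ℕ) :
    Computable (allocated req b) := by
  have hstep : Primrec₂ fun (s : ℕ × ℕ) (r : List Bool × ℕ) =>
      (s.1 + (r.2 + b + 1), s.2 * 2 ^ (r.2 + b + 1) + 2 * 2 ^ s.1) := by
    have hl : Primrec fun q : (ℕ × ℕ) × (List Bool × ℕ) => q.2.2 + b + 1 :=
      Primrec.succ.comp (Primrec.nat_add.comp (Primrec.snd.comp Primrec.snd) (Primrec.const b))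
    have h1 : Primrec fun q : (ℕ × ℕ) × (List Bool × ℕ) => q.1.1 := Primrec.fst.comp Primrec.fst
    have h2 : Primrec fun q : (ℕ × ℕ) × (List Bool × ℕ) => q.1.2 := Primrec.snd.comp Primrec.fst
    exact Primrec.pair (Primrec.nat_add.comp h1 hl)
      (Primrec.nat_add.comp (Primrec.nat_mul.comp h2 (primrec_nat_pow.comp (Primrec.const 2) hl))
        (Primrec.nat_mul.comp (Primrec.const 2) (primrec_nat_pow.comp (Primrec.const 2) h1)))
  have hrec : Computable₂ fun (_ : ℕ) (q : ℕ × (ℕ × ℕ)) =>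
      (Option.casesOn (motive := fun _ => ℕ × ℕ) (req q.1) q.2 fun r =>
        (q.2.1 + (r.2 + b + 1), q.2.2 * 2 ^ (r.2 + b + 1) + 2 * 2 ^ q.2.1)) := by
    refine Computable.option_casesOn
      (hreq.comp (Computable.fst.comp Computable.snd)) (Computable.snd.comp Computable.snd) ?_
    exact hstep.to_comp.comp (Computable.snd.comp (Computable.snd.comp Computable.fst))
      Computable.snd
  refine (Computable.nat_rec (f := fun e : ℕ => e) (g := fun _ => ((0, 0) : ℕ × ℕ)) Computable.id
    (Computable.const _) hrec).of_eq fun e => ?_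
  induction e with
  | zero => rfl
  | succ e ih =>
    simp only at ih
    simp only [allocated, ih]
    cases req e <;> rfl

theorem computable_codeword {req : ℕ → Option (List Bool × ℕ)} (hreq : Computable req) (b : ℕ) :
    Computable₂ (codeword req b) := by
  have h : Primrec₂ fun (s : ℕ × ℕ) (l : ℕ) => s.2 * 2 ^ (l + b + 1) / 2 ^ s.1 + 1 := by
    have hl : Primrec fun q : (ℕ × ℕ) × ℕ => q.2 + b + 1 :=
      Primrec.succ.comp (Primrec.nat_add.comp Primrec.snd (Primrec.const b))
    refine Primrec.succ.comp (Primrec.nat_div.comp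
      (Primrec.nat_mul.comp (Primrec.snd.comp Primrec.fst)
        (primrec_nat_pow.comp (Primrec.const 2) hl))
      (primrec_nat_pow.comp (Primrec.const 2) (Primrec.fst.comp Primrec.fst)))
  exact h.to_comp.comp ((computable_allocated hreq b).comp Computable.fst) Computable.snd

theorem computable_serve {req : ℕ → Option (List Bool × ℕ)} (hreq : Computable req) (b : ℕ) :
    Computable₂ (serve req b) := by
  have hstep : Primrec₂ (serveWith b) := by
    refine Primrec.ite (PrimrecPred.and ?_ ?_)
      (Primrec.option_some.comp (Primrec.fst.comp Primrec.snd)) (Primrec.const none)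
    · exact Primrec.eq.comp (Primrec.list_length.comp (Primrec.fst.comp Primrec.fst))
        (Primrec.succ.comp
          (Primrec.nat_add.comp (Primrec.snd.comp Primrec.snd) (Primrec.const b)))
    · exact Primrec.eq.comp (primrec_msbVal.comp (Primrec.fst.comp Primrec.fst))
        (Primrec.snd.comp Primrec.fst)
  have hpair : Computable fun a : (List Bool × ℕ) × (List Bool × ℕ) =>
      (a.1.1, codeword req b a.1.2 a.2.2) :=
    Computable.pair (Computable.fst.comp Computable.fst)
      ((computable_codeword hreq b).comp (Computable.snd.comp Computable.fst)
        (Computable.snd.comp Computable.snd))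
  exact Computable.option_bind (hreq.comp Computable.snd)
    (Computable₂.comp hstep.to_comp hpair Computable.snd)

/-- The left end of the free interval as a real number. -/
noncomputable def allocatedReal (req : ℕ → Option (List Bool × ℕ)) (b e : ℕ) : ℝ :=
  (allocated req b e).2 / 2 ^ (allocated req b e).1

theorem allocatedReal_succ (req : ℕ → Option (List Bool × ℕ)) (b e : ℕ) :
    allocatedReal req b (e + 1) =
      allocatedReal req b e + (requestWeight (req e)).toReal / 2 ^ b := by
  rcases h : req e with _ | ⟨x, l⟩
  · simp [allocatedReal, allocated, h, requestWeight]
  · simp only [allocatedReal, allocated, h, requestWeight, ENNReal.toReal_pow, ENNReal.toReal_inv,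
      ENNReal.toReal_ofNat, pow_add, pow_one, inv_pow]
    push_cast
    field_simp

theorem allocatedReal_mono (req : ℕ → Option (List Bool × ℕ)) (b : ℕ) :
    Monotone (allocatedReal req b) := by
  refine monotone_nat_of_le_succ fun e => ?_
  rw [allocatedReal_succ]
  have : 0 ≤ (requestWeight (req e)).toReal / 2 ^ b := by positivity
  linarith

theorem requestWeight_ne_top (r : Option (List Bool × ℕ)) : requestWeight r ≠ ∞ := by
  rcases r with _ | ⟨x, l⟩
  · simp [requestWeight]
  · simp [requestWeight]

theorem allocatedReal_le_one {req : ℕ → Option (List Bool × ℕ)} {b : ℕ}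
    (hw : ∑' e, requestWeight (req e) ≤ 2 ^ b) (e : ℕ) : allocatedReal req b e ≤ 1 := by
  have key : allocatedReal req b e =
      (∑ i ∈ Finset.range e, requestWeight (req i)).toReal / 2 ^ b := by
    induction e with
    | zero => simp [allocatedReal, allocated]
    | succ e ih =>
      rw [allocatedReal_succ, ih, Finset.sum_range_succ, ENNReal.toReal_add _
        (requestWeight_ne_top _), add_div]
      exact ENNReal.sum_ne_top.2 fun i _ => requestWeight_ne_top _
  rw [key, div_le_one (by positivity)]
  have := ENNReal.toReal_mono (by simp) ((ENNReal.sum_le_tsum (Finset.range e)).trans hw)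
  simpa using this

theorem codeword_bounds {req : ℕ → Option (List Bool × ℕ)} {b e l : ℕ} {x : List Bool}
    (h : req e = some (x, l)) :
    allocatedReal req b e ≤ codeword req b e l / 2 ^ (l + b + 1) ∧
      ((codeword req b e l : ℝ) + 1) / 2 ^ (l + b + 1) ≤ allocatedReal req b (e + 1) := by
  have hs : allocatedReal req b (e + 1) = allocatedReal req b e + 2 / 2 ^ (l + b + 1) := by
    rw [allocatedReal_succ, h]
    simp only [requestWeight, ENNReal.toReal_pow, ENNReal.toReal_inv,
      ENNReal.toReal_ofNat, pow_add, pow_one, inv_pow]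
    field_simp
  -- Rounding the left end up to the grid of mesh `2 ^ (-(l + b + 1))` costs at most one cell, so
  -- one whole cell still fits into the two that are allocated.
  have hc : ((codeword req b e l : ℕ) : ℝ) =
      ⌊allocatedReal req b e * 2 ^ (l + b + 1)⌋₊ + 1 := by
    have : allocatedReal req b e * 2 ^ (l + b + 1) =
        (((allocated req b e).2 * 2 ^ (l + b + 1) : ℕ) : ℝ) / ((2 ^ (allocated req b e).1 : ℕ)) := by
      rw [allocatedReal]; push_cast; ring
    rw [this, Nat.floor_div_eq_div, codeword]
    push_cast; rfl
  have h0 : 0 ≤ allocatedReal req b e := by unfold allocatedReal; positivity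
  have hp : (0 : ℝ) < 2 ^ (l + b + 1) := by positivity
  rw [hs, hc, le_div_iff₀ hp, div_le_iff₀ hp, add_mul, div_mul_cancel₀ _ hp.ne']
  have h1 := Nat.lt_floor_add_one (allocatedReal req b e * 2 ^ (l + b + 1))
  have h2 := Nat.floor_le (a := allocatedReal req b e * 2 ^ (l + b + 1)) (by positivity)
  constructor <;> linarith

/-- Different requests own dyadic intervals that do not overlap, whereas the interval of `p` is
contained in that of its prefix `q`. -/
theorem index_eq_of_prefix {req : ℕ → Option (List Bool × ℕ)} {b d e : ℕ} {p q x z : List Bool}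
    (hq : serve req b q d = some x) (hp : serve req b p e = some z) (hqp : q <+: p) : d = e := by
  obtain ⟨r, rfl⟩ := hqp
  obtain ⟨l, hl, hlen, hval⟩ := serve_eq_some.1 hq
  obtain ⟨m, hm, hlen', hval'⟩ := serve_eq_some.1 hp
  obtain ⟨a1, a2⟩ := codeword_bounds (b := b) hl
  obtain ⟨c1, c2⟩ := codeword_bounds (b := b) hm
  obtain ⟨v1, v2⟩ := msbVal_append q r
  rw [← hlen, ← hval] at a1 a2
  rw [← hlen', ← hval', List.length_append, pow_add] at c1 c2
  have v1' : (msbVal q : ℝ) * 2 ^ r.length ≤ msbVal (q ++ r) := by exact_mod_cast v1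
  have v2' : (msbVal (q ++ r) : ℝ) + 1 ≤ (msbVal q + 1) * 2 ^ r.length := by exact_mod_cast v2
  have hq0 : (0 : ℝ) < 2 ^ q.length := by positivity
  have hr0 : (0 : ℝ) < 2 ^ r.length := by positivity
  rcases lt_trichotomy d e with h | h | h
  · have h1 := (a2.trans (allocatedReal_mono req b (Nat.succ_le_of_lt h))).trans c1
    rw [div_le_div_iff₀ hq0 (by positivity)] at h1
    have : ((msbVal q : ℝ) + 1) * 2 ^ r.length ≤ msbVal (q ++ r) :=
      le_of_mul_le_mul_right (by linarith) hq0
    linarith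
  · exact h
  · have h1 := (c2.trans (allocatedReal_mono req b (Nat.succ_le_of_lt h))).trans a1
    rw [div_le_div_iff₀ (by positivity) hq0] at h1
    have : (msbVal (q ++ r) : ℝ) + 1 ≤ msbVal q * 2 ^ r.length :=
      le_of_mul_le_mul_right (by linarith) hq0
    linarith

theorem prefixFree_requestMachine (req : ℕ → Option (List Bool × ℕ)) (b : ℕ) :
    PrefixFree (requestMachine req b) := by
  intro y p q hp hq hqp
  obtain ⟨e, z, hz⟩ := Nat.rfindOpt_dom.1 hp
  obtain ⟨d, x, hx⟩ := Nat.rfindOpt_dom.1 hq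
  obtain rfl := index_eq_of_prefix hx hz hqp
  obtain ⟨l, hl, hlen, _⟩ := serve_eq_some.1 hx
  obtain ⟨m, hm, hlen', _⟩ := serve_eq_some.1 hz
  refine hqp.eq_of_length ?_
  rw [hl] at hm
  simp only [Option.some.injEq, Prod.mk.injEq] at hm
  rw [hlen, hlen', hm.2]

/-- If a computable sequence of requests has bounded total weight, then a prefix-free optimal
machine serves all its requests up to an additive constant. -/
theorem IsPrefixOptimal.exists_complexity_le {V : Machine} (hV : IsPrefixOptimal V)
    {req : ℕ → Option (List Bool × ℕ)} (hreq : Computable req) {b : ℕ}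
    (hw : ∑' e, requestWeight (req e) ≤ 2 ^ b) :
    ∃ c : ℕ, ∀ e x l, req e = some (x, l) → complexity V x [] ≤ (l + c : ℕ) := by
  have hcomp : Partrec₂ (requestMachine req b) := by
    refine Partrec.rfindOpt (f := fun q : List Bool × List Bool => serve req b q.1) ?_
    exact (computable_serve hreq b).comp (Computable.fst.comp Computable.fst) Computable.snd
  obtain ⟨c, hc⟩ := hV.2.2 _ hcomp (prefixFree_requestMachine req b)
  refine ⟨b + 1 + c, fun e x l h => ?_⟩
  -- The weight bound keeps all allocated intervals inside the unit interval, so the codeword fits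
  -- into `l + b + 1` bits.
  have hlt : codeword req b e l < 2 ^ (l + b + 1) := by
    have h1 := (codeword_bounds (b := b) h).2.trans (allocatedReal_le_one hw _)
    rw [div_le_one (by positivity)] at h1
    have : codeword req b e l + 1 ≤ 2 ^ (l + b + 1) := by exact_mod_cast h1
    omega
  obtain ⟨p, hlen, hval⟩ := exists_msbVal hlt
  have hs : serve req b p e = some x := serve_eq_some.2 ⟨l, h, hlen, hval⟩
  have hx : x ∈ requestMachine req b p [] := by
    have hd : (requestMachine req b p []).Dom := Nat.rfindOpt_dom.2 ⟨e, x, hs⟩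
    obtain ⟨z, hz⟩ := Part.dom_iff_mem.1 hd
    obtain ⟨d, hzd⟩ := Nat.rfindOpt_spec hz
    obtain rfl := index_eq_of_prefix hzd hs List.prefix_rfl
    rw [Option.mem_def, hs, Option.some_inj] at hzd
    exact hzd ▸ hz
  refine (hc x []).trans ((add_le_add_left (complexity_le_of_mem hx) _).trans ?_)
  rw [hlen]
  push_cast
  exact le_of_eq (by ring)

/-! ### The game -/

/-- The parameters of a game: the additive constant `c` that the game takes into account, the length
`n` of the strings it is played on, and a number `s` such that the prefix-free programs for
strings of length `n` have total weight at least `2 ^ (-s)`. -/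
abbrev Params : Type := ℕ × ℕ × ℕ

namespace Params

/-- The difference between the bounds of consecutive stages. -/
def gap (g : Params) : ℕ := 2 * g.1 + 5

/-- The binary logarithm of the number of stages. -/
def logStages (g : Params) : ℕ := Nat.log 2 g.2.1 - g.gap

/-- The binary logarithm of the number of strings in play at stage `i`. -/
def logSize (g : Params) (i : ℕ) : ℕ := g.2.1 - (i - 1) * g.gap

/-- The lower end of the range of complexities that belongs to stage `i`. -/
def lower (g : Params) (i : ℕ) : ℕ := g.2.2 + g.logStages + g.logSize i - 3

/-- The length of programs that is requested for the strings in play at stage `i`. -/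
def requestLength (g : Params) (i : ℕ) : ℕ := g.2.2 + g.1 + 1 + g.logStages + g.logSize i

end Params

variable (A B : ℕ → List Bool → List Bool → Option (List Bool))

/-- By time `t`, a program for `x` shorter than `b` is found. -/
def IsLow (t b : ℕ) (x : List Bool) : Prop :=
  ∃ p ∈ shortStrings b, A t p [] = some x

/-- By time `t`, a program shorter than `d` is found that, given `x`, outputs a number in the
range of stage `i`. -/
def IsHit (g : Params) (t i : ℕ) (x : List Bool) : Prop :=
  ∃ q ∈ shortStrings (g.logStages - 1), ∃ z ∈ (B t q x).toList,
    g.lower i ≤ lsbVal z ∧ lsbVal z < g.lower i + g.gap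

open Classical in
/-- The contribution of `p` to the weight, in units of `2 ^ (-t)`, of the programs for strings of
length `n` found by time `t`. -/
noncomputable def massOf (t n : ℕ) (p : List Bool) : ℕ :=
  if (A t p []).map List.length = some n then 2 ^ (t - p.length) else 0

/-- By time `t`, programs for strings of length `n` of total weight at least `2 ^ (-s)` are
found. -/
def Launch (g : Params) (t : ℕ) : Prop :=
  2 ^ t ≤ 2 ^ g.2.2 * ((shortStrings (t + 1)).map (massOf A t g.2.1)).sum

/-- By time `t`, all strings in play at stage `i` have left the range of the stage or have
been hit in it. -/
def Settled (g : Params) (t i : ℕ) (S : List (List Bool)) : Prop :=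
  ∀ x ∈ S, IsLow A t (g.lower i) x ∨ IsHit B g t i x

open Classical in
/-- The strings kept in play after stage `i`, preferably those that have been hit. -/
noncomputable def nextStrings (g : Params) (t i : ℕ) (S : List (List Bool)) : List (List Bool) :=
  (S.filter (fun x => IsHit B g t i x) ++ S.filter fun x => ¬ IsHit B g t i x).take
    (2 ^ g.logSize (i + 1))

open Classical in
/-- One step of the game, at time `t`. -/
noncomputable def gameStep (g : Params) (t : ℕ) (st : ℕ × List (List Bool)) :
    ℕ × List (List Bool) :=
  if st.1 = 0 then if Launch A g t then (1, st.2) else st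
  else if Settled A B g t st.1 st.2 then (st.1 + 1, nextStrings B g t st.1 st.2) else st

/-- The stage of the game and the strings in play at time `t`; stage `0` means that the game has
not been launched. -/
noncomputable def gameState (g : Params) : ℕ → ℕ × List (List Bool)
  | 0 => (0, strings g.2.1)
  | t + 1 => gameStep A B g t (gameState g t)

/-- A new stage within the bounds of the game is entered at time `t`. -/
def Entered (g : Params) (t : ℕ) : Prop :=
  (gameState A B g t).1 ≠ (gameState A B g (t + 1)).1 ∧
    (gameState A B g (t + 1)).1 ≤ 2 ^ g.logStages

open Classical in
/-- The request issued for the `k`-th string in play when a new stage is entered at time `t`. -/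
noncomputable def gameRequest (q : Params × ℕ × ℕ) : Option (List Bool × ℕ) :=
  if Entered A B q.1 q.2.1 then
    ((gameState A B q.1 (q.2.1 + 1)).2[q.2.2]?).map fun x =>
      (x, q.1.requestLength (gameState A B q.1 (q.2.1 + 1)).1)
  else none

/-- The requests of all games in one sequence. -/
noncomputable def requests (e : ℕ) : Option (List Bool × ℕ) :=
  gameRequest A B (Denumerable.ofNat (Params × ℕ × ℕ) e)

/-! ### Computability of the game -/

section Computability

open Primrec

theorem primrec_log_two : Primrec (Nat.log 2) := by
  have h : PrimrecRel fun (n k : ℕ) => 2 ^ k ≤ n :=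
    (nat_le.comp (primrec_nat_pow.comp (const 2) snd) fst).primrecRel
  refine (nat_findGreatest (f := fun n : ℕ => n) .id h).of_eq fun n => ?_
  rw [Nat.findGreatest_eq_iff]
  rcases Nat.eq_zero_or_pos n with rfl | hn
  · simp
  · refine ⟨(Nat.log_lt_self 2 hn.ne').le, fun _ => Nat.pow_log_le_self 2 hn.ne', fun k hk _ => ?_⟩
    exact not_le.2 (Nat.lt_pow_of_log_lt one_lt_two hk)

theorem primrec_gap : Primrec Params.gap :=
  nat_add.comp (nat_mul.comp (const 2) fst) (const 5)

theorem primrec_logStages : Primrec Params.logStages :=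
  nat_sub.comp (primrec_log_two.comp (fst.comp snd)) primrec_gap

theorem primrec_logSize : Primrec₂ Params.logSize :=
  nat_sub.comp (fst.comp (snd.comp fst))
    (nat_mul.comp (nat_sub.comp snd (const 1)) (primrec_gap.comp fst))

theorem primrec_lower : Primrec₂ Params.lower :=
  nat_sub.comp (nat_add.comp (nat_add.comp (snd.comp (snd.comp fst)) (primrec_logStages.comp fst))
    primrec_logSize) (const 3)

theorem primrec_requestLength : Primrec₂ Params.requestLength :=
  nat_add.comp (nat_add.comp (nat_add.comp (nat_add.comp (snd.comp (snd.comp fst))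
    (fst.comp fst)) (const 1)) (primrec_logStages.comp fst)) primrec_logSize

variable {A B} {U V : Machine}

theorem IsStage.primrec_comp (hA : IsStage V A) {α : Type*} [Primcodable α] {f : α → ℕ}
    {p y : α → List Bool} (hf : Primrec f) (hp : Primrec p) (hy : Primrec y) :
    Primrec fun a => A (f a) (p a) (y a) :=
  hA.primrec.comp (hf.pair (hp.pair hy))

theorem primrecPred_isLow (hA : IsStage V A) :
    PrimrecPred fun q : ℕ × ℕ × List Bool => IsLow A q.1 q.2.1 q.2.2 := by
  refine PrimrecPred.exists_mem_of (primrec_shortStrings.comp (fst.comp snd)) ?_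
  exact (Primrec.eq.comp (hA.primrec_comp (fst.comp fst) snd (const []))
    (option_some.comp (snd.comp (snd.comp fst)))).primrecRel

theorem primrecPred_isHit (hB : IsStage U B) :
    PrimrecPred fun q : (Params × ℕ × ℕ) × List Bool => IsHit B q.1.1 q.1.2.1 q.1.2.2 q.2 := by
  refine PrimrecPred.exists_mem_of (primrec_shortStrings.comp
    (nat_sub.comp (primrec_logStages.comp (fst.comp fst)) (const 1))) ?_
  have hg : Primrec fun q : (((Params × ℕ × ℕ) × List Bool) × List Bool) × List Bool =>
      q.1.1.1.1 := fst.comp (fst.comp (fst.comp fst))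
  have hl : Primrec fun q : (((Params × ℕ × ℕ) × List Bool) × List Bool) × List Bool =>
      q.1.1.1.1.lower q.1.1.1.2.2 :=
    primrec_lower.comp hg (snd.comp (snd.comp (fst.comp (fst.comp fst))))
  have hR : PrimrecRel fun (q : ((Params × ℕ × ℕ) × List Bool) × List Bool) (z : List Bool) =>
      q.1.1.1.lower q.1.1.2.2 ≤ lsbVal z ∧ lsbVal z < q.1.1.1.lower q.1.1.2.2 + q.1.1.1.gap :=
    (PrimrecPred.and (nat_le.comp hl (primrec_lsbVal.comp snd))
      (nat_lt.comp (primrec_lsbVal.comp snd)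
        (nat_add.comp hl (primrec_gap.comp hg)))).primrecRel
  have hf : Primrec fun q : ((Params × ℕ × ℕ) × List Bool) × List Bool =>
      (B q.1.1.2.1 q.2 q.1.2).toList :=
    optionToList.comp (hB.primrec_comp (fst.comp (snd.comp (fst.comp fst))) snd (snd.comp fst))
  exact (PrimrecPred.exists_mem_of hf hR).primrecRel

theorem primrec_massOf (hA : IsStage V A) :
    Primrec fun q : (ℕ × ℕ) × List Bool => massOf A q.1.1 q.1.2 q.2 := by
  refine ite ?_ ?_ (const 0)
  · exact Primrec.eq.comp (option_map (hA.primrec_comp (fst.comp fst) snd (const []))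
      (list_length.comp snd)) (option_some.comp (snd.comp fst))
  · exact primrec_nat_pow.comp (const 2) (nat_sub.comp (fst.comp fst) (list_length.comp snd))

theorem primrecPred_launch (hA : IsStage V A) :
    PrimrecPred fun q : Params × ℕ => Launch A q.1 q.2 := by
  refine nat_le.comp (primrec_nat_pow.comp (const 2) snd) (nat_mul.comp
    (primrec_nat_pow.comp (const 2) (snd.comp (snd.comp fst))) (primrec_sum.comp
      (list_map (primrec_shortStrings.comp (succ.comp snd)) ?_)))
  exact (primrec_massOf hA).comp
    (((snd.comp fst).pair (fst.comp (snd.comp (fst.comp fst)))).pair snd)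

theorem primrecPred_settled (hA : IsStage V A) (hB : IsStage U B) :
    PrimrecPred fun q : (Params × ℕ × ℕ) × List (List Bool) =>
      Settled A B q.1.1 q.1.2.1 q.1.2.2 q.2 := by
  have hR : PrimrecRel fun (q : (Params × ℕ × ℕ) × List (List Bool)) (x : List Bool) =>
      IsLow A q.1.2.1 (q.1.1.lower q.1.2.2) x ∨ IsHit B q.1.1 q.1.2.1 q.1.2.2 x :=
    (PrimrecPred.or
      ((primrecPred_isLow hA).comp ((fst.comp (snd.comp (fst.comp fst))).pair
        ((primrec_lower.comp (fst.comp (fst.comp fst)) (snd.comp (snd.comp (fst.comp fst)))).pair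
          snd)))
      ((primrecPred_isHit hB).comp ((fst.comp fst).pair snd))).primrecRel
  exact PrimrecPred.forall_mem_of snd hR

theorem primrec_nextStrings (hB : IsStage U B) :
    Primrec fun q : (Params × ℕ × ℕ) × List (List Bool) =>
      nextStrings B q.1.1 q.1.2.1 q.1.2.2 q.2 := by
  classical
  have h : PrimrecRel fun (q : (Params × ℕ × ℕ) × List (List Bool)) (x : List Bool) =>
      IsHit B q.1.1 q.1.2.1 q.1.2.2 x :=
    ((primrecPred_isHit hB).comp ((fst.comp fst).pair snd)).primrecRel
  refine (list_take.comp (primrec_nat_pow.comp (const 2) (primrec_logSize.comp (fst.comp fst)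
    (succ.comp (snd.comp (snd.comp fst))))) (list_append.comp (Primrec.filter_of snd h)
      (Primrec.filter_of snd h.not))).of_eq fun q => ?_
  unfold nextStrings
  congr!

theorem primrec_gameStep (hA : IsStage V A) (hB : IsStage U B) :
    Primrec fun q : (Params × ℕ) × ℕ × List (List Bool) => gameStep A B q.1.1 q.1.2 q.2 := by
  have hq : Primrec fun q : (Params × ℕ) × ℕ × List (List Bool) =>
      (((q.1.1, q.1.2, q.2.1), q.2.2) : (Params × ℕ × ℕ) × List (List Bool)) :=
    ((fst.comp fst).pair ((snd.comp fst).pair (fst.comp snd))).pair (snd.comp snd)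
  have hl : PrimrecPred fun q : (Params × ℕ) × ℕ × List (List Bool) =>
      Launch A q.1.1 q.1.2 := (primrecPred_launch hA).comp fst
  have hs : PrimrecPred fun q : (Params × ℕ) × ℕ × List (List Bool) =>
      Settled A B q.1.1 q.1.2 q.2.1 q.2.2 := (primrecPred_settled hA hB).comp hq
  have hn : Primrec fun q : (Params × ℕ) × ℕ × List (List Bool) =>
      nextStrings B q.1.1 q.1.2 q.2.1 q.2.2 := (primrec_nextStrings hB).comp hq
  have h1 : Primrec fun q : (Params × ℕ) × ℕ × List (List Bool) => (1, q.2.2) :=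
    (const 1).pair (snd.comp snd)
  have h2 : Primrec fun q : (Params × ℕ) × ℕ × List (List Bool) =>
      (q.2.1 + 1, nextStrings B q.1.1 q.1.2 q.2.1 q.2.2) := (succ.comp (fst.comp snd)).pair hn
  have h0 : PrimrecPred fun q : (Params × ℕ) × ℕ × List (List Bool) => q.2.1 = 0 :=
    Primrec.eq.comp (fst.comp snd) (const 0)
  classical
  refine (Primrec.ite h0 (Primrec.ite hl h1 snd) (Primrec.ite hs h2 snd)).of_eq fun q => ?_
  unfold gameStep
  congr!

theorem primrec_gameState (hA : IsStage V A) (hB : IsStage U B) :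
    Primrec₂ (gameState A B) := by
  have h : Primrec₂ fun (g : Params) (q : ℕ × ℕ × List (List Bool)) =>
      gameStep A B g q.1 q.2 :=
    (primrec_gameStep hA hB).comp ((fst.pair (fst.comp snd)).pair (snd.comp snd))
  have h0 : Primrec fun g : Params => ((0, strings g.2.1) : ℕ × List (List Bool)) :=
    (const 0).pair (primrec_strings.comp (fst.comp snd))
  refine (nat_rec h0 h).of_eq fun g t => ?_
  induction t with
  | zero => rfl
  | succ t ih => simp only [gameState, ← ih]

theorem primrec_gameRequest (hA : IsStage V A) (hB : IsStage U B) :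
    Primrec (gameRequest A B) := by
  have h0 : Primrec fun q : Params × ℕ × ℕ => gameState A B q.1 q.2.1 :=
    (primrec_gameState hA hB).comp fst (fst.comp snd)
  have h1 : Primrec fun q : Params × ℕ × ℕ => gameState A B q.1 (q.2.1 + 1) :=
    (primrec_gameState hA hB).comp fst (succ.comp (fst.comp snd))
  have he : PrimrecPred fun q : Params × ℕ × ℕ => Entered A B q.1 q.2.1 :=
    PrimrecPred.and (PrimrecPred.not (Primrec.eq.comp (fst.comp h0) (fst.comp h1)))
      (nat_le.comp (fst.comp h1) (primrec_nat_pow.comp (const 2) (primrec_logStages.comp fst)))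
  have hm : Primrec fun q : Params × ℕ × ℕ =>
      ((gameState A B q.1 (q.2.1 + 1)).2[q.2.2]?).map fun x =>
        (x, q.1.requestLength (gameState A B q.1 (q.2.1 + 1)).1) := by
    refine option_map (list_getElem?.comp (snd.comp h1) (snd.comp snd)) ?_
    exact snd.pair (primrec_requestLength.comp (fst.comp fst) (fst.comp (h1.comp fst)))
  classical
  refine (Primrec.ite he hm (const none)).of_eq fun q => ?_
  unfold gameRequest
  congr!

theorem computable_requests (hA : IsStage V A) (hB : IsStage U B) :
    Computable (requests A B) :=
  ((primrec_gameRequest hA hB).comp (Primrec.ofNat _)).to_comp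

end Computability

/-! ### The weight of all requests -/

theorem nodup_shortStrings (b : ℕ) : (shortStrings b).Nodup := by
  refine List.nodup_flatMap.2 ⟨fun n _ => nodup_strings n, ?_⟩
  refine List.nodup_range.imp ?_
  intro m n hmn p hp hq
  exact hmn ((mem_strings.1 hp).symm.trans (mem_strings.1 hq))

/-- Kraft's inequality for finite prefix-free codes. -/
theorem sum_le_one_of_prefixFree {F : Finset (List Bool)}
    (hF : ∀ p ∈ F, ∀ q ∈ F, q <+: p → q = p) : ∑ p ∈ F, (2⁻¹ : ℝ≥0∞) ^ p.length ≤ 1 := by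
  classical
  obtain ⟨N, hN⟩ : ∃ N, ∀ p ∈ F, p.length ≤ N :=
    ⟨F.sup List.length, fun p hp => Finset.le_sup (f := List.length) hp⟩
  have hcard : ∑ p ∈ F, 2 ^ (N - p.length) ≤ 2 ^ N := by
    let ext := fun p : List Bool => (strings (N - p.length)).toFinset.image (p ++ ·)
    have h1 : ∀ p, (ext p).card = 2 ^ (N - p.length) := fun p => by
      rw [Finset.card_image_of_injective _ (List.append_right_injective p),
        List.toFinset_card_of_nodup (nodup_strings _), length_strings]
    have hdisj : (F : Set (List Bool)).PairwiseDisjoint ext := by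
      intro p hp q hq hpq
      refine Finset.disjoint_left.2 fun w hw hw' => hpq ?_
      obtain ⟨r, _, rfl⟩ := Finset.mem_image.1 hw
      obtain ⟨r', _, h⟩ := Finset.mem_image.1 hw'
      rcases List.prefix_or_prefix_of_prefix (List.prefix_append p r)
        ⟨r', h⟩ with h' | h'
      · exact hF q hq p hp h'
      · exact (hF p hp q hq h').symm
    calc ∑ p ∈ F, 2 ^ (N - p.length) = (F.biUnion ext).card := by
          rw [Finset.card_biUnion hdisj]
          exact Finset.sum_congr rfl fun p _ => (h1 p).symm
      _ ≤ (strings N).toFinset.card := by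
          refine Finset.card_le_card fun w hw => ?_
          obtain ⟨p, hp, hw⟩ := Finset.mem_biUnion.1 hw
          obtain ⟨r, hr, rfl⟩ := Finset.mem_image.1 hw
          have h2 := hN p hp
          rw [List.mem_toFinset, mem_strings] at hr ⊢
          rw [List.length_append, hr]
          omega
      _ = 2 ^ N := by rw [List.toFinset_card_of_nodup (nodup_strings _), length_strings]
  have heq : ∀ p ∈ F, (2⁻¹ : ℝ≥0∞) ^ p.length = 2⁻¹ ^ N * 2 ^ (N - p.length) := fun p hp => by
    obtain ⟨d, rfl⟩ := Nat.exists_eq_add_of_le (hN p hp)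
    rw [Nat.add_sub_cancel_left, pow_add, mul_assoc, ← mul_pow,
      ENNReal.inv_mul_cancel (by simp) (by simp), one_pow, mul_one]
  rw [Finset.sum_congr rfl heq, ← Finset.mul_sum]
  calc (2⁻¹ : ℝ≥0∞) ^ N * ∑ p ∈ F, 2 ^ (N - p.length)
      ≤ 2⁻¹ ^ N * 2 ^ N := by gcongr; exact_mod_cast hcard
    _ = 1 := by rw [← mul_pow, ENNReal.inv_mul_cancel (by simp) (by simp), one_pow]

open Classical in
/-- The total weight of the programs for strings of length `n`. -/
noncomputable def progMass (V : Machine) (n : ℕ) : ℝ≥0∞ :=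
  ∑' p : List Bool, if ∃ x ∈ V p [], x.length = n then 2⁻¹ ^ p.length else 0

theorem tsum_progMass_le {V : Machine} (hV : PrefixFree V) : ∑' n, progMass V n ≤ 1 := by
  classical
  unfold progMass
  rw [ENNReal.tsum_comm, ENNReal.tsum_eq_iSup_sum]
  refine iSup_le fun F => ?_
  have h : ∀ p : List Bool,
      (∑' n, if ∃ x ∈ V p [], x.length = n then (2⁻¹ : ℝ≥0∞) ^ p.length else 0) ≤
        if (V p []).Dom then 2⁻¹ ^ p.length else 0 := by
    intro p
    split_ifs with hp
    · obtain ⟨x, hx⟩ := Part.dom_iff_mem.1 hp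
      rw [tsum_eq_single x.length]
      · split_ifs <;> simp
      · intro n hn
        refine if_neg ?_
        rintro ⟨z, hz, rfl⟩
        exact hn (by rw [Part.mem_unique hz hx])
    · refine le_of_eq (ENNReal.tsum_eq_zero.2 fun n => if_neg ?_)
      rintro ⟨z, hz, _⟩
      exact hp (Part.dom_iff_mem.2 ⟨z, hz⟩)
  refine (Finset.sum_le_sum fun p _ => h p).trans ?_
  rw [← Finset.sum_filter]
  refine sum_le_one_of_prefixFree fun p hp q hq hqp => ?_
  exact hV [] p q (Finset.mem_filter.1 hp).2 (Finset.mem_filter.1 hq).2 hqp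

theorem tsum_half_pow_add (a : ℕ) : ∑' i, (2⁻¹ : ℝ≥0∞) ^ (a + i) = 2 * 2⁻¹ ^ a := by
  simp_rw [pow_add]
  rw [ENNReal.tsum_mul_left, ENNReal.tsum_geometric, ENNReal.one_sub_inv_two, inv_inv, mul_comm]

/-- The sum is dominated by the geometric series that starts at the least `s` with `P s`. -/
theorem tsum_half_pow_le (P : ℕ → Prop) [DecidablePred P] {b : ℝ≥0∞} (h : ∀ s, P s → (2⁻¹ : ℝ≥0∞) ^ s ≤ b) :
    ∑' s, (if P s then (2⁻¹ : ℝ≥0∞) ^ s else 0) ≤ 2 * b := by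
  by_cases hP : ∃ s, P s
  · have hsupp : (Function.support fun s => if P s then (2⁻¹ : ℝ≥0∞) ^ s else 0) ⊆
        Set.range (Nat.find hP + ·) := by
      intro s hs
      have : P s := by
        by_contra hn
        exact hs (if_neg hn)
      exact ⟨s - Nat.find hP, Nat.add_sub_cancel' (Nat.find_min' hP this)⟩
    rw [← (add_right_injective (Nat.find hP)).tsum_eq hsupp]
    calc _ ≤ ∑' i, (2⁻¹ : ℝ≥0∞) ^ (Nat.find hP + i) := by
          refine ENNReal.tsum_le_tsum fun i => ?_
          split_ifs <;> simp
      _ = 2 * 2⁻¹ ^ Nat.find hP := tsum_half_pow_add _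
      _ ≤ 2 * b := by gcongr; exact h _ (Nat.find_spec hP)
  · rw [ENNReal.tsum_eq_zero.2 fun s => if_neg fun hs => hP ⟨s, hs⟩]
    exact zero_le

variable {A B} {U V : Machine}

theorem le_progMass_of_launch (hA : IsStage V A) {g : Params} {t : ℕ} (h : Launch A g t) :
    2⁻¹ ^ g.2.2 ≤ progMass V g.2.1 := by
  classical
  have hterm : ∀ p ∈ (shortStrings (t + 1)).toFinset, (massOf A t g.2.1 p : ℝ≥0∞) ≤
      2 ^ t * if ∃ x ∈ V p [], x.length = g.2.1 then 2⁻¹ ^ p.length else 0 := by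
    intro p hp
    rw [List.mem_toFinset, mem_shortStrings] at hp
    unfold massOf
    split_ifs with h1 h2 h2
    · have : (2 : ℝ≥0∞) ^ t = 2 ^ (t - p.length) * 2 ^ p.length := by
        rw [← pow_add]; congr 1; omega
      rw [this, mul_assoc, ← mul_pow, ENNReal.mul_inv_cancel (by simp) (by simp)]
      simp
    · obtain ⟨x, hx, hl⟩ := Option.map_eq_some_iff.1 h1
      exact absurd ⟨x, hA.mem_iff.2 ⟨t, hx⟩, hl⟩ h2
    · simp
    · simp
  have hsum : (((shortStrings (t + 1)).map (massOf A t g.2.1)).sum : ℝ≥0∞) ≤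
      2 ^ t * progMass V g.2.1 := by
    rw [← List.sum_toFinset _ (nodup_shortStrings _)]
    push_cast
    refine (Finset.sum_le_sum hterm).trans ?_
    rw [← Finset.mul_sum]
    gcongr
    exact ENNReal.sum_le_tsum _
  have h' : (2 : ℝ≥0∞) ^ t ≤
      2 ^ g.2.2 * (((shortStrings (t + 1)).map (massOf A t g.2.1)).sum : ℕ) := by
    exact_mod_cast h
  have h2 : (2 : ℝ≥0∞) ^ t * 1 ≤ 2 ^ t * (2 ^ g.2.2 * progMass V g.2.1) := by
    rw [mul_one, mul_left_comm]
    exact h'.trans (by gcongr)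
  have h3 := (ENNReal.mul_le_mul_iff_right (by simp) (by simp)).1 h2
  calc (2⁻¹ : ℝ≥0∞) ^ g.2.2 = 2⁻¹ ^ g.2.2 * 1 := (mul_one _).symm
    _ ≤ 2⁻¹ ^ g.2.2 * (2 ^ g.2.2 * progMass V g.2.1) := by gcongr
    _ = progMass V g.2.1 := by
      rw [← mul_assoc, ← mul_pow, ENNReal.inv_mul_cancel (by simp) (by simp), one_pow, one_mul]

/-! ### Number of stages and weight of the requests of a game -/

theorem gameState_succ (g : Params) (t : ℕ) :
    gameState A B g (t + 1) = gameStep A B g t (gameState A B g t) := rfl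

theorem gameStep_cases (g : Params) (t : ℕ) (st : ℕ × List (List Bool)) :
    gameStep A B g t st = st ∨ (st.1 = 0 ∧ Launch A g t ∧ gameStep A B g t st = (1, st.2)) ∨
      (st.1 ≠ 0 ∧ Settled A B g t st.1 st.2 ∧
        gameStep A B g t st = (st.1 + 1, nextStrings B g t st.1 st.2)) := by
  unfold gameStep
  split_ifs <;> simp_all

theorem length_gameState_le (g : Params) (t : ℕ) :
    (gameState A B g t).2.length ≤ 2 ^ g.logSize (gameState A B g t).1 := by
  induction t with
  | zero => simp [gameState, length_strings, Params.logSize]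
  | succ t ih =>
    rw [gameState_succ]
    rcases gameStep_cases (A := A) (B := B) g t (gameState A B g t) with h | ⟨h0, -, h⟩ | ⟨-, -, h⟩
    · rwa [h]
    · rw [h]
      rw [h0] at ih
      simpa [Params.logSize] using ih
    · rw [h]
      simp [nextStrings]

theorem stage_eq_zero {g : Params} (h : ¬ ∃ t, Launch A g t) (t : ℕ) :
    (gameState A B g t).1 = 0 := by
  induction t with
  | zero => rfl
  | succ t ih =>
    rw [gameState_succ]
    rcases gameStep_cases (A := A) (B := B) g t (gameState A B g t) with h1 | ⟨-, h1, -⟩ | ⟨h1, -, -⟩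
    · rwa [h1]
    · exact absurd ⟨t, h1⟩ h
    · exact absurd ih h1

theorem stage_succ (g : Params) (t : ℕ) :
    (gameState A B g (t + 1)).1 = (gameState A B g t).1 ∨
      (gameState A B g (t + 1)).1 = (gameState A B g t).1 + 1 := by
  rw [gameState_succ]
  rcases gameStep_cases (A := A) (B := B) g t (gameState A B g t) with h | ⟨h0, -, h⟩ | ⟨-, -, h⟩
  · exact Or.inl (by rw [h])
  · exact Or.inr (by rw [h, h0])
  · exact Or.inr (by rw [h])

open Classical in
-- Each entry raises the stage number by one. The bound by the number of stages serves launched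
-- games; the bound by the current stage shows that a game never launched issues no requests.
theorem card_entered_le (g : Params) (T : ℕ) :
    ((Finset.range T).filter (Entered A B g)).card ≤
      min (gameState A B g T).1 (2 ^ g.logStages) := by
  induction T with
  | zero => simp
  | succ T ih =>
    rw [Finset.range_add_one, Finset.filter_insert]
    have hs := stage_succ (A := A) (B := B) g T
    split_ifs with h
    · rw [Finset.card_insert_of_notMem (by simp)]
      have h1 := h.1
      have h2 := h.2
      omega
    · omega

open Classical in
theorem tsum_stage_requests_le (g : Params) (t : ℕ) :
    ∑' k, requestWeight (gameRequest A B (g, t, k)) ≤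
      if Entered A B g t then 2⁻¹ ^ (g.2.2 + g.1 + 1 + g.logStages) else 0 := by
  split_ifs with h
  · have hterm : ∀ k, requestWeight (gameRequest A B (g, t, k)) =
        if k < (gameState A B g (t + 1)).2.length then
          2⁻¹ ^ g.requestLength (gameState A B g (t + 1)).1 else 0 := by
      intro k
      simp only [gameRequest, if_pos h]
      split_ifs with hk
      · simp [List.getElem?_eq_getElem hk, requestWeight]
      · simp [List.getElem?_eq_none (not_lt.1 hk), requestWeight]
    simp_rw [hterm]
    rw [tsum_eq_sum (s := Finset.range (gameState A B g (t + 1)).2.length)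
      (by intro k hk; rw [Finset.mem_range] at hk; exact if_neg hk),
      Finset.sum_congr rfl fun k hk => if_pos (Finset.mem_range.1 hk), Finset.sum_const,
      Finset.card_range, nsmul_eq_mul]
    have hlen : ((gameState A B g (t + 1)).2.length : ℝ≥0∞) ≤
        2 ^ g.logSize (gameState A B g (t + 1)).1 := by
      exact_mod_cast length_gameState_le g (t + 1)
    calc _ ≤ 2 ^ g.logSize (gameState A B g (t + 1)).1 *
          (2⁻¹ : ℝ≥0∞) ^ g.requestLength (gameState A B g (t + 1)).1 := by gcongr
      _ = 2⁻¹ ^ (g.2.2 + g.1 + 1 + g.logStages) := by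
        rw [Params.requestLength, pow_add _ _ (g.logSize _), mul_left_comm, ← mul_pow,
          ENNReal.mul_inv_cancel (by simp) (by simp), one_pow, mul_one]
  · refine le_of_eq (ENNReal.tsum_eq_zero.2 fun k => ?_)
    simp [gameRequest, if_neg h, requestWeight]

open Classical in
theorem tsum_game_requests_le (g : Params) :
    ∑' t, ∑' k, requestWeight (gameRequest A B (g, t, k)) ≤
      if ∃ t, Launch A g t then 2⁻¹ ^ (g.2.2 + g.1 + 1) else 0 := by
  refine (ENNReal.tsum_le_tsum fun t => tsum_stage_requests_le g t).trans ?_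
  rw [ENNReal.tsum_eq_iSup_nat]
  refine iSup_le fun T => ?_
  rw [← Finset.sum_filter, Finset.sum_const, nsmul_eq_mul]
  have hcard := card_entered_le (A := A) (B := B) g T
  split_ifs with h
  · have h1 : (((Finset.range T).filter (Entered A B g)).card : ℝ≥0∞) ≤ 2 ^ g.logStages := by
      exact_mod_cast hcard.trans (min_le_right _ _)
    calc _ ≤ (2 : ℝ≥0∞) ^ g.logStages * 2⁻¹ ^ (g.2.2 + g.1 + 1 + g.logStages) := by gcongr
      _ = 2⁻¹ ^ (g.2.2 + g.1 + 1) := by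
        rw [pow_add _ _ g.logStages, mul_left_comm, ← mul_pow,
          ENNReal.mul_inv_cancel (by simp) (by simp), one_pow, mul_one]
  · rw [stage_eq_zero h T] at hcard
    simp [Nat.le_zero.1 (hcard.trans (min_le_left _ _))]

/-- A launched game requests weight at most `2 ^ (-(s + c + 1))`. Summing over launched `s` gives at
most `2 ^ (-(1 + c)) * 2 * progMass V n`; the sum over `n` is controlled by Kraft's inequality, and
that over `c` is geometric. -/
theorem tsum_requests_le (hA : IsStage V A) (hV : PrefixFree V) :
    ∑' e, requestWeight (requests A B e) ≤ 2 ^ 1 := by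
  classical
  have h1 : ∑' e, requestWeight (requests A B e) =
      ∑' q : Params × ℕ × ℕ, requestWeight (gameRequest A B q) :=
    (Denumerable.eqv (Params × ℕ × ℕ)).symm.tsum_eq fun q => requestWeight (gameRequest A B q)
  have hs : ∀ c n : ℕ, ∑' s : ℕ, ∑' t, ∑' k, requestWeight (gameRequest A B ((c, n, s), t, k)) ≤
      2⁻¹ ^ (1 + c) * (2 * progMass V n) := by
    intro c n
    refine (ENNReal.tsum_le_tsum fun s => tsum_game_requests_le (c, n, s)).trans ?_
    calc _ = ∑' s, (2⁻¹ : ℝ≥0∞) ^ (1 + c) *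
          if ∃ t, Launch A (c, n, s) t then 2⁻¹ ^ s else 0 := by
          refine tsum_congr fun s => ?_
          split_ifs
          · rw [← pow_add]; congr 1; simp only; ring
          · rw [mul_zero]
      _ ≤ _ := by
          rw [ENNReal.tsum_mul_left]
          gcongr
          exact tsum_half_pow_le _ fun s ⟨t, ht⟩ => le_progMass_of_launch hA ht
  rw [h1, ENNReal.tsum_prod']
  have h2 : ∀ g : Params, ∑' b : ℕ × ℕ, requestWeight (gameRequest A B (g, b)) =
      ∑' t, ∑' k, requestWeight (gameRequest A B (g, t, k)) := fun g => ENNReal.tsum_prod'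
  simp_rw [h2]
  rw [ENNReal.tsum_prod']
  calc _ ≤ ∑' c : ℕ, (2⁻¹ : ℝ≥0∞) ^ (1 + c) * (2 * 1) := by
        refine ENNReal.tsum_le_tsum fun c => ?_
        rw [ENNReal.tsum_prod']
        refine (ENNReal.tsum_le_tsum fun n => hs c n).trans ?_
        rw [ENNReal.tsum_mul_left, ENNReal.tsum_mul_left]
        gcongr
        exact tsum_progMass_le hV
    _ = 2 ^ 1 := by
        rw [ENNReal.tsum_mul_right, tsum_half_pow_add, pow_one,
          ENNReal.mul_inv_cancel (by simp) (by simp), one_mul, mul_one, pow_one]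

/-! ### Analysis of the game -/

open Filter

theorem exists_launch (hA : IsStage V A) {c n : ℕ} {p x : List Bool} (hx : x ∈ V p [])
    (hn : x.length = n) : ∃ t, Launch A (c, n, p.length) t := by
  obtain ⟨t₀, ht₀⟩ := hA.mem_iff.1 hx
  have hmax : A (max t₀ p.length) p [] = some x := hA.mono (le_max_left _ _) ht₀
  have hp : p.length ≤ max t₀ p.length := le_max_right _ _
  generalize max t₀ p.length = t at hmax hp
  refine ⟨t, ?_⟩
  have hmass : massOf A t n p = 2 ^ (t - p.length) := by
    rw [massOf, if_pos]
    rw [hmax, Option.map_some, hn]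
  have hle := List.single_le_sum (l := (shortStrings (t + 1)).map (massOf A t n))
    (fun _ _ => Nat.zero_le _) _
    (List.mem_map_of_mem (mem_shortStrings.2 (Nat.lt_succ_of_le hp)))
  calc 2 ^ t = 2 ^ p.length * 2 ^ (t - p.length) := by
        rw [← pow_add, Nat.add_sub_cancel' hp]
    _ ≤ _ := Nat.mul_le_mul_left _ (hmass ▸ hle)

/-- Any finite part of the weight is found by some time `t`, at which the launch condition fails. -/
theorem progMass_le_of_not_launch (hA : IsStage V A) {g : Params} (h : ∀ t, ¬ Launch A g t) :
    progMass V g.2.1 ≤ 2⁻¹ ^ g.2.2 := by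
  classical
  unfold progMass
  rw [ENNReal.tsum_eq_iSup_sum]
  refine iSup_le fun F => ?_
  have hev : ∀ᶠ t in atTop, ∀ p ∈ F, (∃ x ∈ V p [], x.length = g.2.1) →
      p.length ≤ t ∧ (A t p []).map List.length = some g.2.1 := by
    refine (eventually_all_finset F).2 fun p _ => ?_
    by_cases hp : ∃ x ∈ V p [], x.length = g.2.1
    · obtain ⟨x, hx, hl⟩ := hp
      obtain ⟨t₀, ht₀⟩ := hA.mem_iff.1 hx
      filter_upwards [eventually_ge_atTop t₀, eventually_ge_atTop p.length] with t h1 h2 _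
      exact ⟨h2, by rw [hA.mono h1 ht₀, Option.map_some, hl]⟩
    · exact Eventually.of_forall fun t h' => absurd h' hp
  obtain ⟨t, ht⟩ := hev.exists
  have hlt : ((2 ^ g.2.2 * ((shortStrings (t + 1)).map (massOf A t g.2.1)).sum : ℕ) : ℝ≥0∞) ≤
      ((2 ^ t : ℕ) : ℝ≥0∞) := by exact_mod_cast (not_le.1 (h t)).le
  have hcancel : ∀ k : ℕ, (2⁻¹ : ℝ≥0∞) ^ k * 2 ^ k = 1 := fun k => by
    rw [← mul_pow, ENNReal.inv_mul_cancel (by simp) (by simp), one_pow]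
  have hsum : ∑ p ∈ F, (if ∃ x ∈ V p [], x.length = g.2.1 then (2⁻¹ : ℝ≥0∞) ^ p.length else 0) ≤
      2⁻¹ ^ t * (((shortStrings (t + 1)).map (massOf A t g.2.1)).sum : ℕ) := by
    rw [← List.sum_toFinset _ (nodup_shortStrings _), ← Finset.sum_filter]
    push_cast
    rw [Finset.mul_sum]
    calc _ ≤ ∑ p ∈ F.filter (fun p => ∃ x ∈ V p [], x.length = g.2.1),
          2⁻¹ ^ t * (massOf A t g.2.1 p : ℝ≥0∞) := by
          refine Finset.sum_le_sum fun p hp => ?_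
          obtain ⟨hpF, hp⟩ := Finset.mem_filter.1 hp
          obtain ⟨h1, h2⟩ := ht p hpF hp
          rw [massOf, if_pos h2]
          obtain ⟨d, rfl⟩ := Nat.exists_eq_add_of_le h1
          rw [Nat.add_sub_cancel_left, pow_add, mul_assoc]
          push_cast
          rw [hcancel, mul_one]
      _ ≤ _ := by
          refine Finset.sum_le_sum_of_subset fun p hp => ?_
          obtain ⟨hpF, hp⟩ := Finset.mem_filter.1 hp
          exact List.mem_toFinset.2 (mem_shortStrings.2 (Nat.lt_succ_of_le (ht p hpF hp).1))
  refine hsum.trans ?_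
  generalize ((shortStrings (t + 1)).map (massOf A t g.2.1)).sum = N at hlt
  push_cast at hlt
  calc (2⁻¹ : ℝ≥0∞) ^ t * N = 2⁻¹ ^ g.2.2 * (2⁻¹ ^ t * (2 ^ g.2.2 * N)) := by
        rw [mul_left_comm _ ((2 : ℝ≥0∞) ^ g.2.2), ← mul_assoc (2⁻¹ ^ g.2.2), hcancel, one_mul]
    _ ≤ 2⁻¹ ^ g.2.2 * (2⁻¹ ^ t * 2 ^ t) := by gcongr
    _ = 2⁻¹ ^ g.2.2 := by rw [hcancel, mul_one]

/-- Shortest programs of different strings are different, so the left side is a partial sum of the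
right. -/
theorem sum_half_pow_complexity_le {K : List Bool → ℕ} (hK : ∀ x, complexity V x [] = K x)
    (n : ℕ) : ∑ x ∈ (strings n).toFinset, (2⁻¹ : ℝ≥0∞) ^ K x ≤ progMass V n := by
  classical
  have hp : ∀ x, ∃ p, x ∈ V p [] ∧ p.length = K x := fun x => by
    obtain ⟨p, h1, h2, -⟩ := exists_program (hK x).le
    exact ⟨p, h1, by rw [hK] at h2; exact_mod_cast h2.symm⟩
  choose p hp hl using hp
  have hinj : Function.Injective p := fun x y h =>
    Part.mem_unique (hp x) (h ▸ hp y)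
  calc _ = ∑ q ∈ (strings n).toFinset.image p,
        if ∃ x ∈ V q [], x.length = n then (2⁻¹ : ℝ≥0∞) ^ q.length else 0 := by
        rw [Finset.sum_image hinj.injOn]
        refine Finset.sum_congr rfl fun x hx => ?_
        rw [if_pos ⟨x, hp x, mem_strings.1 (List.mem_toFinset.1 hx)⟩, hl]
    _ ≤ _ := ENNReal.sum_le_tsum _

/-- If `s` is minimal such that the game with parameters `c`, `n`, `s` is launched, then the
complexities of strings of length `n` are large on average. -/
theorem exists_launched (hA : IsStage V A) (hV : PrefixFree V) {K : List Bool → ℕ}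
    (hK : ∀ x, complexity V x [] = K x) (c n : ℕ) : ∃ s, (∃ t, Launch A (c, n, s) t) ∧
      ∑ x ∈ (strings n).toFinset, (2⁻¹ : ℝ≥0∞) ^ K x ≤ 2 * 2⁻¹ ^ s := by
  classical
  have hex : ∃ s, ∃ t, Launch A (c, n, s) t := by
    obtain ⟨p, hp, -⟩ := exists_program (hK (List.replicate n false)).le
    exact ⟨_, exists_launch hA hp List.length_replicate⟩
  refine ⟨Nat.find hex, Nat.find_spec hex, (sum_half_pow_complexity_le hK n).trans ?_⟩
  rcases hs : Nat.find hex with _ | s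
  · rw [pow_zero, mul_one]
    refine (ENNReal.le_tsum n).trans ((tsum_progMass_le hV).trans ?_)
    exact one_le_two
  -- The game with the preceding parameter is not launched, so the weight is at most twice `2 ^ (-(s
  -- + 1))`.
  · have hmin : ∀ t, ¬ Launch A (c, n, s) t := fun t ht =>
      Nat.find_min hex (m := s) (by omega) ⟨t, ht⟩
    refine (progMass_le_of_not_launch hA hmin).trans (le_of_eq ?_)
    rw [pow_succ', ← mul_assoc, ENNReal.mul_inv_cancel (by simp) (by simp), one_mul]

/-! ### Few stages are cheap, and few are guessed -/

theorem sum_half_pow_le_of_injOn {J : Finset ℕ} {b : ℕ → ℕ} (hb : Set.InjOn b J) (k : ℕ) :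
    ∑ i ∈ J, (if k < b i then (2⁻¹ : ℝ≥0∞) ^ b i else 0) ≤ 2⁻¹ ^ k := by
  calc _ = ∑ s ∈ J.image b, if k < s then (2⁻¹ : ℝ≥0∞) ^ s else 0 :=
        (Finset.sum_image (f := fun s => if k < s then (2⁻¹ : ℝ≥0∞) ^ s else 0) hb).symm
    _ ≤ _ := ENNReal.sum_le_tsum _
    _ ≤ 2 * 2⁻¹ ^ (k + 1) := tsum_half_pow_le (k < ·) fun s hs =>
        pow_le_pow_right_of_le_one' (by simp) hs
    _ = 2⁻¹ ^ k := by
        rw [pow_succ', ← mul_assoc, ENNReal.mul_inv_cancel (by simp) (by simp), one_mul]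

/-- After exchanging the sums, each `x` is charged `2 ^ (-b i)` for the distinct bounds `b i` above
`K x`, altogether at most `2 ^ (-K x)`. So a string may count as low at many stages at no extra
cost. -/
theorem sum_card_mul_half_pow_le (F : Finset (List Bool)) (K : List Bool → ℕ) {J : Finset ℕ}
    {b : ℕ → ℕ} (hb : Set.InjOn b J) :
    ∑ i ∈ J, ((F.filter fun x => K x < b i).card : ℝ≥0∞) * 2⁻¹ ^ b i ≤
      ∑ x ∈ F, (2⁻¹ : ℝ≥0∞) ^ K x := by
  classical
  calc _ = ∑ i ∈ J, ∑ x ∈ F, if K x < b i then (2⁻¹ : ℝ≥0∞) ^ b i else 0 := by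
        refine Finset.sum_congr rfl fun i _ => ?_
        rw [← Finset.sum_filter, Finset.sum_const, nsmul_eq_mul]
    _ = ∑ x ∈ F, ∑ i ∈ J, if K x < b i then (2⁻¹ : ℝ≥0∞) ^ b i else 0 := Finset.sum_comm
    _ ≤ _ := Finset.sum_le_sum fun x _ => sum_half_pow_le_of_injOn hb _

/-- The strings of a game are long enough for all its stages. -/
structure Params.Large (g : Params) : Prop where
  one_le : 1 ≤ g.logStages
  le_length : 32 ≤ g.2.1
  mul_gap_le : 4 * (2 ^ g.logStages * g.gap) ≤ g.2.1

namespace Params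

/-- The third condition follows from `4 * gap ≤ 2 ^ gap`, true as `gap ≥ 5`, since `2 ^ logStages *
2 ^ gap` is the largest power of two below or equal to the length. -/
theorem large_of_two_pow_le {g : Params} (h : 2 ^ (g.gap + 1) ≤ g.2.1) : g.Large := by
  have hpos : g.2.1 ≠ 0 := by
    intro h0; rw [h0] at h; simp at h
  have hlog : g.gap + 1 ≤ Nat.log 2 g.2.1 := (Nat.le_log_iff_pow_le one_lt_two hpos).2 h
  have hgap : 5 ≤ g.gap := by unfold gap; omega
  have h4 : ∀ k : ℕ, 4 * (k + 5) ≤ 2 ^ (k + 5) := by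
    intro k
    induction k with
    | zero => norm_num
    | succ k ih => rw [show k + 1 + 5 = k + 5 + 1 by ring, pow_succ]; omega
  have h4' : 4 * g.gap ≤ 2 ^ g.gap := by
    have := h4 (g.gap - 5)
    rwa [Nat.sub_add_cancel hgap] at this
  refine ⟨?_, ?_, ?_⟩
  · unfold logStages; omega
  · refine le_trans ?_ h
    calc 32 = 2 ^ 5 := by norm_num
      _ ≤ _ := Nat.pow_le_pow_right two_pos (by omega)
  · calc 4 * (2 ^ g.logStages * g.gap) = 2 ^ g.logStages * (4 * g.gap) := by ring
      _ ≤ 2 ^ g.logStages * 2 ^ g.gap := Nat.mul_le_mul_left _ h4'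
      _ = 2 ^ Nat.log 2 g.2.1 := by
        rw [← pow_add]; congr 1; unfold logStages; omega
      _ ≤ g.2.1 := Nat.pow_log_le_self 2 hpos

variable {g : Params}

theorem Large.logSize_eq (hg : g.Large) {i : ℕ} (hi : i ≤ 2 ^ g.logStages + 1) :
    g.logSize i + (i - 1) * g.gap = g.2.1 ∧ 4 * ((i - 1) * g.gap) ≤ g.2.1 := by
  have h1 : (i - 1) * g.gap ≤ 2 ^ g.logStages * g.gap := Nat.mul_le_mul_right _ (Nat.sub_le_of_le_add hi)
  have h2 := hg.mul_gap_le
  unfold logSize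
  omega

theorem Large.logSize_succ (hg : g.Large) {i : ℕ} (h0 : 1 ≤ i) (hi : i ≤ 2 ^ g.logStages) :
    g.logSize (i + 1) + g.gap = g.logSize i := by
  have h1 := (hg.logSize_eq (i := i) (by omega)).1
  have h2 := (hg.logSize_eq (i := i + 1) (by omega)).1
  have h3 : (i + 1 - 1) * g.gap = (i - 1) * g.gap + g.gap := by
    obtain ⟨j, rfl⟩ := Nat.exists_eq_add_of_le' h0
    simp only [Nat.add_sub_cancel]; ring
  omega

theorem Large.lower_add (hg : g.Large) {i : ℕ} (hi : i ≤ 2 ^ g.logStages + 1) :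
    g.lower i + 3 = g.2.2 + g.logStages + g.logSize i ∧ 3 ≤ g.logSize i ∧ g.2.1 ≤ 2 * g.lower i := by
  have h1 := hg.logSize_eq hi
  have h2 := hg.le_length
  unfold lower
  omega

/-- This explains the value of `gap`: a served request, with overhead `g.1`, yields a complexity of
at most the last number in the range of the stage. -/
theorem Large.requestLength_add (hg : g.Large) {i : ℕ} (hi : i ≤ 2 ^ g.logStages + 1) :
    g.requestLength i + g.1 + 1 = g.lower i + g.gap := by
  have h1 := hg.lower_add hi
  unfold requestLength gap
  omega

theorem Large.lower_add_gap_le (hg : g.Large) {i j : ℕ} (h0 : 1 ≤ i) (hij : i < j)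
    (hj : j ≤ 2 ^ g.logStages + 1) : g.lower j + g.gap ≤ g.lower i := by
  have h1 := hg.lower_add hj
  have h2 := hg.lower_add (i := i) (by omega)
  have h3 := hg.logSize_eq hj
  have h4 := hg.logSize_eq (i := i) (by omega)
  have h5 : (i - 1) * g.gap + g.gap ≤ (j - 1) * g.gap := by
    rw [← Nat.succ_mul]
    exact Nat.mul_le_mul_right _ (by omega)
  omega

theorem Large.injOn_lower (hg : g.Large) :
    Set.InjOn g.lower (Finset.Icc 1 (2 ^ g.logStages) : Finset ℕ) := by
  have hgap : 0 < g.gap := by unfold gap; omega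
  intro i hi j hj h
  simp only [Finset.coe_Icc, Set.mem_Icc] at hi hj
  rcases lt_trichotomy i j with hij | hij | hij
  · have := hg.lower_add_gap_le hi.1 hij (by omega); omega
  · exact hij
  · have := hg.lower_add_gap_le hj.1 hij (by omega); omega

end Params

open Classical in
/-- At stage `i` at least half of the strings in play are known to have complexities below
the range of the stage. -/
def IsCheap (K : List Bool → ℕ) (g : Params) (i : ℕ) : Prop :=
  2 ^ (g.logSize i - 1) ≤
    ((strings g.2.1).toFinset.filter fun x => K x < g.lower i).card

/-- Each cheap stage accounts for weight at least `4 * 2 ^ (-(s + logStages))`, with `s = g.2.2`,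
out of a total of at most `2 * 2 ^ (-s)`. -/
theorem card_cheap_le {g : Params} (hg : g.Large) {K : List Bool → ℕ}
    (hK : ∑ x ∈ (strings g.2.1).toFinset, (2⁻¹ : ℝ≥0∞) ^ K x ≤ 2 * 2⁻¹ ^ g.2.2) {J : Finset ℕ}
    (hJ : J ⊆ Finset.Icc 1 (2 ^ g.logStages)) (hcheap : ∀ i ∈ J, IsCheap K g i) :
    2 * J.card ≤ 2 ^ g.logStages := by
  classical
  have hcancel : ∀ k : ℕ, (2 : ℝ≥0∞) ^ k * 2⁻¹ ^ k = 1 := fun k => by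
    rw [← mul_pow, ENNReal.mul_inv_cancel (by simp) (by simp), one_pow]
  have h1 := (sum_card_mul_half_pow_le (strings g.2.1).toFinset K
    (hg.injOn_lower.mono (Finset.coe_subset.2 hJ))).trans hK
  have hterm : ∀ i ∈ J, (2 : ℝ≥0∞) ^ 2 * 2⁻¹ ^ (g.2.2 + g.logStages) ≤
      (((strings g.2.1).toFinset.filter fun x => K x < g.lower i).card : ℝ≥0∞) *
        2⁻¹ ^ g.lower i := by
    intro i hi
    have hi' := Finset.mem_Icc.1 (hJ hi)
    obtain ⟨h2, h3, -⟩ := hg.lower_add (i := i) (by omega)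
    have hc : (2 : ℝ≥0∞) ^ (g.logSize i - 1) ≤
        (((strings g.2.1).toFinset.filter fun x => K x < g.lower i).card : ℝ≥0∞) := by
      have := hcheap i hi
      unfold IsCheap at this
      exact_mod_cast (by convert this)
    refine le_trans (le_of_eq ?_) (mul_le_mul_left hc _)
    -- With `logSize i = 3 + e` the count `2 ^ (2 + e)` meets the weight `2 ^ (-(s + logStages +
    -- e))`; the `3` subtracted in `lower` leaves the factor `4`.
    obtain ⟨e, he⟩ := Nat.exists_eq_add_of_le h3
    have h4 : g.lower i = g.2.2 + g.logStages + e := by omega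
    rw [h4, he, show 3 + e - 1 = 2 + e by omega, pow_add _ _ e, pow_add _ _ e,
      mul_mul_mul_comm, hcancel, mul_one]
  have h2 := (Finset.sum_le_sum hterm).trans h1
  rw [Finset.sum_const, nsmul_eq_mul, pow_add, ← mul_assoc, ← mul_assoc] at h2
  have h3 : (J.card : ℝ≥0∞) * 2 ^ 2 ≤ 2 * 2 ^ g.logStages := by
    calc (J.card : ℝ≥0∞) * 2 ^ 2
        = (J.card * 2 ^ 2 * 2⁻¹ ^ g.2.2 * 2⁻¹ ^ g.logStages) * (2 ^ g.2.2 * 2 ^ g.logStages) := by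
          rw [mul_assoc _ (2⁻¹ ^ g.2.2), mul_assoc _ (2⁻¹ ^ g.2.2 * _), mul_mul_mul_comm (2⁻¹ ^ g.2.2),
            mul_comm (2⁻¹ ^ g.2.2), hcancel, mul_comm (2⁻¹ ^ g.logStages), hcancel, mul_one,
            mul_one]
      _ ≤ 2 * 2⁻¹ ^ g.2.2 * (2 ^ g.2.2 * 2 ^ g.logStages) := by gcongr
      _ = 2 * 2 ^ g.logStages := by
          rw [mul_assoc, ← mul_assoc (2⁻¹ ^ g.2.2), mul_comm (2⁻¹ ^ g.2.2), hcancel, one_mul]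
  have h4 : J.card * 2 ^ 2 ≤ 2 * 2 ^ g.logStages := by exact_mod_cast h3
  omega

/-- Some program shorter than `g.logStages - 1` outputs, given `x`, a number in the range of
stage `i`. -/
def IsGuessed (U : Machine) (g : Params) (i : ℕ) (x : List Bool) : Prop :=
  ∃ q : List Bool, q.length < g.logStages - 1 ∧ ∃ z ∈ U q x,
    g.lower i ≤ lsbVal z ∧ lsbVal z < g.lower i + g.gap

theorem IsHit.isGuessed (hB : IsStage U B) {g : Params} {t i : ℕ} {x : List Bool}
    (h : IsHit B g t i x) : IsGuessed U g i x := by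
  obtain ⟨q, hq, z, hz, hlt⟩ := h
  exact ⟨q, mem_shortStrings.1 hq, z, hB.mem_iff.2 ⟨t, Option.mem_toList.1 hz⟩, hlt⟩

/-- One program has one output on `x`, which lies in the range of at most one stage. Hence the
stages in `J` need different programs, all shorter than `logStages - 1`. -/
theorem card_guessed_lt {g : Params} (hg : g.Large) {x : List Bool} {J : Finset ℕ}
    (hJ : J ⊆ Finset.Icc 1 (2 ^ g.logStages)) (h : ∀ i ∈ J, IsGuessed U g i x) :
    J.card < 2 ^ (g.logStages - 1) := by
  classical
  choose! q hq z hz hlow hlt using h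
  have hinj : Set.InjOn q J := by
    intro i hi j hj hij
    have hzz : z i = z j := Part.mem_unique (hz i hi) (hij ▸ hz j hj)
    have hi' := Finset.mem_Icc.1 (hJ hi)
    have hj' := Finset.mem_Icc.1 (hJ hj)
    have h1 := hlow i hi
    have h2 := hlt i hi
    have h3 := hlow j hj
    have h4 := hlt j hj
    rw [hzz] at h1 h2
    rcases lt_trichotomy i j with h | h | h
    · have := hg.lower_add_gap_le hi'.1 h (by omega); omega
    · exact h
    · have := hg.lower_add_gap_le hj'.1 h (by omega); omega
  have := card_le_of_length_lt (b := g.logStages - 1) (F := J.image q) (by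
    intro p hp
    obtain ⟨i, hi, rfl⟩ := Finset.mem_image.1 hp
    exact hq i hi)
  rwa [Finset.card_image_of_injOn hinj] at this

/-! ### Course of the game -/

/-- The properties of the set `S` of strings in play at stage `i`. -/
structure Invariant (A B : ℕ → List Bool → List Bool → Option (List Bool)) (U : Machine)
    (K : List Bool → ℕ) (g : Params) (i : ℕ) (S : List (List Bool)) : Prop where
  nodup : S.Nodup
  length_eq : S.length = 2 ^ g.logSize i
  mem_length : ∀ x ∈ S, x.length = g.2.1
  requested : 1 ≤ i → i ≤ 2 ^ g.logStages →
    ∀ x ∈ S, ∃ e, requests A B e = some (x, g.requestLength i)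
  passed : ∀ j, 1 ≤ j → j < i → IsCheap K g j ∨ ∀ x ∈ S, IsGuessed U g j x

theorem IsLow.complexity_lt (hA : IsStage V A) {K : List Bool → ℕ}
    (hK : ∀ x, complexity V x [] = K x) {t b : ℕ} {x : List Bool} (h : IsLow A t b x) :
    K x < b := by
  obtain ⟨p, hp, hx⟩ := h
  have h1 := complexity_le_of_mem (hA.mem_iff.2 ⟨t, hx⟩)
  rw [hK] at h1
  exact (Nat.cast_le.1 h1).trans_lt (mem_shortStrings.1 hp)

/-- If the hit strings do not fill the next set, they are fewer than half of `S`, because the next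
set is smaller by a factor `2 ^ gap`. The rest must be low since the stage is settled. -/
theorem nextStrings_cheap_or_guessed (hA : IsStage V A) (hB : IsStage U B) {K : List Bool → ℕ}
    (hK : ∀ x, complexity V x [] = K x) {g : Params} (hg : g.Large) {t i : ℕ}
    (h0 : 1 ≤ i) (hi : i ≤ 2 ^ g.logStages) {S : List (List Bool)} (hnodup : S.Nodup)
    (hlen : S.length = 2 ^ g.logSize i) (hmem : ∀ x ∈ S, x.length = g.2.1)
    (hs : Settled A B g t i S) :
    IsCheap K g i ∨ ∀ x ∈ nextStrings B g t i S, IsGuessed U g i x := by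
  classical
  by_cases h : 2 ^ g.logSize (i + 1) ≤ (S.filter fun x => IsHit B g t i x).length
  · refine Or.inr fun x hx => ?_
    have hx' : x ∈ S.filter fun x => IsHit B g t i x := by
      unfold nextStrings at hx
      rw [List.take_append_of_le_length (by convert h)] at hx
      convert List.mem_of_mem_take hx
    have := (List.mem_filter.1 hx').2
    exact IsHit.isGuessed hB (by simpa using this)
  · left
    have hsplit := List.length_eq_length_filter_add (l := S) fun x => decide (IsHit B g t i x)
    have hsize := hg.logSize_succ h0 hi
    have hgap : 1 ≤ g.gap := by unfold Params.gap; omega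
    have hpow : 2 ^ g.logSize (i + 1) ≤ 2 ^ (g.logSize i - 1) :=
      Nat.pow_le_pow_right two_pos (by omega)
    have hpow' : 2 ^ g.logSize i = 2 * 2 ^ (g.logSize i - 1) := by
      rw [← pow_succ']; congr 1; omega
    have hcard : 2 ^ (g.logSize i - 1) ≤ (S.filter fun x => !decide (IsHit B g t i x)).length := by
      omega
    unfold IsCheap
    refine hcard.trans ?_
    rw [← List.toFinset_card_of_nodup (hnodup.filter _)]
    refine Finset.card_le_card fun x hx => ?_
    obtain ⟨hxS, hx⟩ := List.mem_filter.1 (List.mem_toFinset.1 hx)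
    refine Finset.mem_filter.2 ⟨List.mem_toFinset.2 (mem_strings.2 (hmem x hxS)), ?_⟩
    refine IsLow.complexity_lt hA hK ((hs x hxS).resolve_right ?_)
    simpa using hx

theorem nextStrings_sub (g : Params) (t i : ℕ) {S : List (List Bool)} (hnodup : S.Nodup)
    (hlen : 2 ^ g.logSize (i + 1) ≤ S.length) :
    (nextStrings B g t i S).Nodup ∧ (nextStrings B g t i S).length = 2 ^ g.logSize (i + 1) ∧
      ∀ x ∈ nextStrings B g t i S, x ∈ S := by
  classical
  have hperm : (S.filter (fun x => decide (IsHit B g t i x)) ++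
      S.filter fun x => decide (¬ IsHit B g t i x)).Perm S := by
    simpa using List.filter_append_perm (fun x => decide (IsHit B g t i x)) S
  have hdef : nextStrings B g t i S = (S.filter (fun x => decide (IsHit B g t i x)) ++
      S.filter fun x => decide (¬ IsHit B g t i x)).take (2 ^ g.logSize (i + 1)) := by
    unfold nextStrings; congr!
  rw [hdef]
  refine ⟨(hperm.nodup_iff.2 hnodup).sublist (List.take_sublist _ _), ?_, fun x hx => ?_⟩
  · rw [List.length_take, hperm.length_eq, min_eq_left hlen]
  · exact hperm.mem_iff.1 (List.mem_of_mem_take hx)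

theorem requests_of_entered {g : Params} {t : ℕ} (h : Entered A B g t) {x : List Bool}
    (hx : x ∈ (gameState A B g (t + 1)).2) :
    ∃ e, requests A B e = some (x, g.requestLength (gameState A B g (t + 1)).1) := by
  obtain ⟨k, hk, rfl⟩ := List.mem_iff_getElem.1 hx
  refine ⟨Encodable.encode (g, t, k), ?_⟩
  rw [requests, Denumerable.ofNat_encode, gameRequest, if_pos h, List.getElem?_eq_getElem hk,
    Option.map_some]

theorem invariant_gameState (hA : IsStage V A) (hB : IsStage U B) {K : List Bool → ℕ}
    (hK : ∀ x, complexity V x [] = K x) {g : Params} (hg : g.Large) (t : ℕ)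
    (ht : (gameState A B g t).1 ≤ 2 ^ g.logStages + 1) :
    Invariant A B U K g (gameState A B g t).1 (gameState A B g t).2 := by
  induction t with
  | zero =>
    refine ⟨nodup_strings _, ?_, fun x hx => mem_strings.1 hx, ?_, ?_⟩
    · simp [gameState, length_strings, Params.logSize]
    · intro h; simp [gameState] at h
    · intro j _ h; simp [gameState] at h
  | succ t ih =>
    have hreq : (gameState A B g t).1 ≠ (gameState A B g (t + 1)).1 →
        (gameState A B g (t + 1)).1 ≤ 2 ^ g.logStages → ∀ x ∈ (gameState A B g (t + 1)).2,
          ∃ e, requests A B e = some (x, g.requestLength (gameState A B g (t + 1)).1) :=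
      fun h1 h2 x hx => requests_of_entered ⟨h1, h2⟩ hx
    have hle : (gameState A B g t).1 ≤ (gameState A B g (t + 1)).1 := by
      rcases stage_succ (A := A) (B := B) g t with h | h <;> omega
    obtain ⟨i1, i2, i3, i4, i5⟩ := ih (hle.trans ht)
    rcases gameStep_cases (A := A) (B := B) g t (gameState A B g t) with h | ⟨h0, -, h⟩ | ⟨h0, hs, h⟩
    · rw [gameState_succ, h]
      exact ⟨i1, i2, i3, i4, i5⟩
    · rw [← gameState_succ] at h
      rw [h] at hreq ⊢
      rw [h0] at hreq i2
      -- Launching keeps all strings: stages `0` and `1` have the same size because `i - 1` is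
      -- truncated.
      exact ⟨i1, by simpa [Params.logSize] using i2, i3, fun _ => hreq zero_ne_one,
        fun j h1 h2 => absurd h1 (not_le.2 h2)⟩
    · rw [← gameState_succ] at h
      rw [h] at hreq ht ⊢
      have hi : (gameState A B g t).1 ≤ 2 ^ g.logStages := Nat.le_of_succ_le_succ ht
      have h1 : 1 ≤ (gameState A B g t).1 := Nat.one_le_iff_ne_zero.2 h0
      obtain ⟨n1, n2, n3⟩ := nextStrings_sub (B := B) g t (gameState A B g t).1 i1 (by
        rw [i2]
        refine Nat.pow_le_pow_right two_pos ?_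
        have := hg.logSize_succ h1 hi
        omega)
      refine ⟨n1, n2, fun x hx => i3 x (n3 x hx), fun _ => hreq (by simp), fun j hj hji => ?_⟩
      rcases (Nat.lt_succ_iff.1 hji).lt_or_eq with hlt | rfl
      · exact (i5 j hj hlt).imp_right fun h x hx => h x (n3 x hx)
      · exact nextStrings_cheap_or_guessed hA hB hK hg h1 hi i1 i2 i3 hs

/-- The served requests put `K x` below the top of the range. If it is also below the bottom, a
short program for `x` shows up in time; otherwise `hU` provides a program that hits `K x` itself. -/
theorem exists_settled (hA : IsStage V A) (hB : IsStage U B) {K : List Bool → ℕ}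
    (hK : ∀ x, complexity V x [] = K x) {g : Params} (hg : g.Large) {i : ℕ}
    (hi : i ≤ 2 ^ g.logStages) {S : List (List Bool)} (hmem : ∀ x ∈ S, x.length = g.2.1)
    (hreq : ∀ x ∈ S, K x ≤ g.requestLength i + g.1)
    (hU : ∀ x, x.length = g.2.1 → g.2.1 ≤ 2 * K x →
      complexity U (K x).bits x < (g.logStages - 1 : ℕ)) :
    ∀ᶠ t in atTop, Settled A B g t i S := by
  classical
  have h : ∀ x ∈ S.toFinset, ∀ᶠ t in atTop, IsLow A t (g.lower i) x ∨ IsHit B g t i x := by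
    intro x hx
    rw [List.mem_toFinset] at hx
    rcases lt_or_ge (K x) (g.lower i) with hlt | hge
    · obtain ⟨p, hp, -, hl⟩ := exists_program (hK x).le
      obtain ⟨t₀, ht₀⟩ := hA.mem_iff.1 hp
      filter_upwards [eventually_ge_atTop t₀] with t ht
      exact Or.inl ⟨p, mem_shortStrings.2 (hl.trans_lt hlt), hA.mono ht ht₀⟩
    · have hlow := hg.lower_add (i := i) (by omega)
      have hr := hg.requestLength_add (i := i) (by omega)
      have hx' := hreq x hx
      -- `K x ≥ lower i`, and `lower i` is at least half the length of `x`.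
      have hc := hU x (hmem x hx) (by omega)
      obtain ⟨k, hk⟩ := ENat.ne_top_iff_exists.1 hc.ne_top
      obtain ⟨q, hq, hl, -⟩ := exists_program hk.ge
      rw [hl, Nat.cast_lt] at hc
      obtain ⟨t₀, ht₀⟩ := hB.mem_iff.1 hq
      filter_upwards [eventually_ge_atTop t₀] with t ht
      refine Or.inr ⟨q, mem_shortStrings.2 hc, _, Option.mem_toList.2 (hB.mono ht ht₀), ?_⟩
      rw [lsbVal_bits]
      omega
  filter_upwards [(eventually_all_finset _).2 h] with t ht x hx
  exact ht x (List.mem_toFinset.2 hx)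

theorem exists_stage_eq_one {g : Params} (h : ∃ t, Launch A g t) :
    ∃ t, (gameState A B g t).1 = 1 := by
  by_contra! hne
  have h0 : ∀ t, (gameState A B g t).1 = 0 := by
    intro t
    induction t with
    | zero => rfl
    | succ t ih =>
      have h1 := hne (t + 1)
      rcases stage_succ (A := A) (B := B) g t with h | h <;> omega
  obtain ⟨t, ht⟩ := h
  refine hne (t + 1) ?_
  rw [gameState_succ, gameStep, if_pos (h0 t), if_pos ht]

theorem exists_stage_succ {g : Params} {t : ℕ} (h0 : (gameState A B g t).1 ≠ 0)
    (h : ∀ᶠ r in atTop, Settled A B g r (gameState A B g t).1 (gameState A B g t).2) :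
    ∃ r, (gameState A B g r).1 = (gameState A B g t).1 + 1 := by
  by_contra! hne
  -- A stage that is never left has a constant set of strings, so being settled eventually applies
  -- to the actual state.
  have hconst : ∀ r, gameState A B g (t + r) = gameState A B g t := by
    intro r
    induction r with
    | zero => rfl
    | succ r ih =>
      rcases gameStep_cases (A := A) (B := B) g (t + r) (gameState A B g (t + r)) with
        h | ⟨h1, -, -⟩ | ⟨-, -, h⟩
      · rw [← add_assoc, gameState_succ, h, ih]
      · rw [ih] at h1
        exact absurd h1 h0
      · refine absurd ?_ (hne (t + r + 1))
        rw [gameState_succ, h, ih]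
  obtain ⟨r, hr, htr⟩ := (h.and (eventually_ge_atTop t)).exists
  obtain ⟨d, rfl⟩ := Nat.exists_eq_add_of_le htr
  refine hne (t + d + 1) ?_
  rw [gameState_succ, hconst d, gameStep, if_neg h0, if_pos hr]

/-- In a launched game on long strings, some string has a complexity that is hard to find. -/
theorem exists_le_complexity_bits (hA : IsStage V A) (hB : IsStage U B) {K : List Bool → ℕ}
    (hK : ∀ x, complexity V x [] = K x) {g : Params} (hg : g.Large)
    (hreq : ∀ e x l, requests A B e = some (x, l) → K x ≤ l + g.1) (hl : ∃ t, Launch A g t)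
    (hsum : ∑ x ∈ (strings g.2.1).toFinset, (2⁻¹ : ℝ≥0∞) ^ K x ≤ 2 * 2⁻¹ ^ g.2.2) :
    ∃ x : List Bool, x.length = g.2.1 ∧ g.2.1 ≤ 2 * K x ∧
      ((g.logStages - 1 : ℕ) : ℕ∞) ≤ complexity U (K x).bits x := by
  classical
  by_contra! hU
  have hreach : ∀ i ≤ 2 ^ g.logStages, ∃ t, (gameState A B g t).1 = i + 1 := by
    intro i hi
    induction i with
    | zero => exact exists_stage_eq_one hl
    | succ i ih =>
      obtain ⟨t, ht⟩ := ih (by omega)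
      have inv := invariant_gameState hA hB hK hg t (by omega)
      obtain ⟨r, hr⟩ := exists_stage_succ (A := A) (B := B) (g := g) (t := t) (by omega)
        (exists_settled hA hB hK hg (by omega) inv.mem_length
          (fun x hx => by
            obtain ⟨e, he⟩ := inv.requested (by omega) (by omega) x hx
            exact hreq e x _ he) hU)
      exact ⟨r, by omega⟩
  -- Stage `2 ^ logStages + 1` issues no requests; reaching it means that every real stage has been
  -- settled.
  obtain ⟨t, ht⟩ := hreach _ le_rfl
  have inv := invariant_gameState hA hB hK hg t ht.le
  have hpos : 0 < (gameState A B g t).2.length := by rw [inv.length_eq]; positivity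
  obtain ⟨x, hx⟩ := List.exists_mem_of_length_pos hpos
  have hcheap := card_cheap_le hg hsum
    (J := (Finset.Icc 1 (2 ^ g.logStages)).filter (IsCheap K g)) (Finset.filter_subset _ _)
    fun i hi => (Finset.mem_filter.1 hi).2
  have hguess := card_guessed_lt (U := U) hg (x := x)
    (J := (Finset.Icc 1 (2 ^ g.logStages)).filter fun i => ¬ IsCheap K g i)
    (Finset.filter_subset _ _) fun i hi => by
      obtain ⟨hi, hn⟩ := Finset.mem_filter.1 hi
      rw [Finset.mem_Icc] at hi
      exact (inv.passed i hi.1 (by omega)).resolve_left hn x hx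
  have hcard := Finset.card_filter_add_card_filter_not (s := Finset.Icc 1 (2 ^ g.logStages))
    (IsCheap K g)
  rw [Nat.card_Icc] at hcard
  have hpow : 2 ^ g.logStages = 2 * 2 ^ (g.logStages - 1) := by
    rw [← pow_succ']; congr 1; have := hg.one_le; omega
  -- At most half of the stages are cheap and fewer than half are not.
  omega

/-- Some string of every length has at least half its length as complexity. -/
theorem exists_le_two_mul_complexity {K : List Bool → ℕ}
    (hK : ∀ x, complexity V x [] = K x) (n : ℕ) :
    ∃ x : List Bool, x.length = n ∧ n ≤ 2 * K x := by
  classical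
  by_contra! h
  have hp : ∀ x, ∃ p, x ∈ V p [] ∧ p.length ≤ K x := fun x => by
    obtain ⟨p, h1, -, h2⟩ := exists_program (hK x).le
    exact ⟨p, h1, h2⟩
  choose p hp hl using hp
  have hinj : Function.Injective p := fun x y hxy => Part.mem_unique (hp x) (hxy ▸ hp y)
  have hcard := card_le_of_length_lt (b := n) (F := (strings n).toFinset.image p) (by
    intro q hq
    obtain ⟨x, hx, rfl⟩ := Finset.mem_image.1 hq
    have h1 := h x (mem_strings.1 (List.mem_toFinset.1 hx))
    have h2 := hl x
    omega)
  rw [Finset.card_image_of_injective _ hinj, List.toFinset_card_of_nodup (nodup_strings n),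
    length_strings] at hcard
  omega

end Kolmogorov

/-! ### The theorem -/

theorem theorem2 (U V : Kolmogorov.Machine)
    (hU : Kolmogorov.IsOptimal U) (hV : Kolmogorov.IsPrefixOptimal V) :
    ∃ c : ℕ, ∀ n : ℕ, ∃ x : List Bool, x.length = n ∧
      ∃ k l m : ℕ,
        Kolmogorov.complexity V x [] = k ∧
        Kolmogorov.complexity U k.bits x = l ∧
        Kolmogorov.complexity V k.bits x = m ∧
        Real.logb 2 n - c ≤ l ∧
        (n : ℝ) / 2 ≤ k ∧
        Real.logb 2 n - c ≤ m := by
  open Kolmogorov in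
  obtain ⟨A, hA⟩ := exists_isStage hV.1
  obtain ⟨B, hB⟩ := exists_isStage hU.1
  obtain ⟨c, hc⟩ := hV.exists_complexity_le (computable_requests hA hB)
    (tsum_requests_le hA hV.2.1)
  obtain ⟨c₁, hc₁⟩ := hU.2 V hV.1
  choose K hK using hV.exists_eq
  have hK0 : ∀ x, complexity V x [] = K x [] := fun x => hK x []
  have hfin : ∀ x y, ∃ l : ℕ, complexity U x y = l ∧ l ≤ K x y + c₁ := fun x y => by
    have h : complexity U x y ≤ ((K x y + c₁ : ℕ) : ℕ∞) := by
      have := hc₁ x y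
      rw [hK] at this
      exact_mod_cast this
    obtain ⟨p, -, h1, h2⟩ := exists_program h
    exact ⟨_, h1, h2⟩
  have hreq : ∀ e x l, requests A B e = some (x, l) → K x [] ≤ l + c := fun e x l h => by
    have := hc e x l h
    rw [hK] at this
    exact_mod_cast this
  -- `2 * c + 5` is the gap; one more comes from the bound `logStages - 1`, and one from rounding
  -- the logarithm. `c₁` pays for passing from plain to prefix-free complexity.
  refine ⟨2 * c + 7 + c₁, fun n => ?_⟩
  have hmain : ∃ x : List Bool, x.length = n ∧ n ≤ 2 * K x [] ∧
      ∀ l : ℕ, complexity U (K x []).bits x = l → Real.logb 2 n ≤ l + (2 * c + 7 : ℕ) := by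
    -- For short strings the logarithmic bound is void, and only `K x ≥ n / 2` has to be arranged,
    -- by counting.
    rcases lt_or_ge n (2 ^ (2 * c + 6)) with hn | hn
    · obtain ⟨x, hx, hx'⟩ := exists_le_two_mul_complexity hK0 n
      refine ⟨x, hx, hx', fun l _ => ?_⟩
      have h1 : Real.logb 2 n ≤ (2 * c + 6 : ℕ) := by
        rcases Nat.eq_zero_or_pos n with rfl | hpos
        · simp only [Nat.cast_zero, Real.logb_zero]; positivity
        · rw [Real.logb_le_iff_le_rpow one_lt_two (by exact_mod_cast hpos), Real.rpow_natCast]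
          exact_mod_cast hn.le
      have h2 : (0 : ℝ) ≤ l := Nat.cast_nonneg l
      push_cast at h1 ⊢
      linarith
    · obtain ⟨s, hs, hsum⟩ := exists_launched hA hV.2.1 hK0 c n
      have hg : Params.Large (c, n, s) := Params.large_of_two_pow_le hn
      obtain ⟨x, hx, hx', hle⟩ := exists_le_complexity_bits hA hB hK0 hg hreq hs hsum
      refine ⟨x, hx, hx', fun l hl => ?_⟩
      rw [hl, Nat.cast_le] at hle
      have hlog : Nat.log 2 n + 1 ≤ l + (2 * c + 7) := by
        have h : Params.logStages (c, n, s) = Nat.log 2 n - (2 * c + 5) := rfl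
        omega
      have hpos : 0 < n := lt_of_lt_of_le (by positivity) hn
      refine le_trans ?_ (b := ((Nat.log 2 n + 1 : ℕ) : ℝ)) (by exact_mod_cast hlog)
      rw [Real.logb_le_iff_le_rpow one_lt_two (by exact_mod_cast hpos), Real.rpow_natCast]
      exact_mod_cast (Nat.lt_pow_succ_log_self one_lt_two n).le
  obtain ⟨x, hx, hx', hlog⟩ := hmain
  obtain ⟨l, hl, hlm⟩ := hfin (K x []).bits x
  refine ⟨x, hx, K x [], l, K (K x []).bits x, hK _ _, hl, hK _ _, ?_, ?_, ?_⟩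
  · have h1 := hlog l hl
    have h2 : (0 : ℝ) ≤ c₁ := Nat.cast_nonneg c₁
    push_cast at h1 ⊢
    linarith
  · have : (n : ℝ) ≤ 2 * K x [] := by exact_mod_cast hx'
    linarith
  · have h1 := hlog l hl
    have h2 : (l : ℝ) ≤ K (K x []).bits x + c₁ := by exact_mod_cast hlm
    push_cast at h1 ⊢
    linarith
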